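/- Identify a point $(x,y)$ of the plane with the complex number $z=x+iy$, and let $H^+=\{x+iy : x\ge 0\}$ be the closed right half-plane. For $w=u+iv\in H^+$ let $w_*=-u+iv$ be its reflection in the imaginary axis, and define the reduced kernel $$K(z,w)=\log\frac{2}{|z-w|+|z-w_*|}\in(-\infty,+\infty]\qquad(z,w\in H^+),$$ with the value $+\infty$ where the denominator vanishes. For $B\subset H^+$ let $\Gamma(B)=\{(x\cos t,\,y,\,x\sin t) : x+iy\in B,\ 0\le t<2\pi\}\subset\mathbb R^3$ be the set obtained by revolving $B$ about the $y$-axis. For a compact set $A$ let $A_+$ be its right-most part, that is, the set of those $x+iy\in A$ such that $x'\le x$ for every $x'+iy\in A$. For a compact set $S$ (in $\mathbb C$ or $\mathbb R^3$) and a kernel $k$, the equilibrium measure of $S$ for $k$ is the unique minimizer of the energy $\iint k\,d\mu\,d\mu$ over the Borel probability measures $\mu$ supported on $S$, provided that it exists and has finite energy. **Theorem.** Let $A\subset H^+$ be a non-empty compact set such that $A_+$ is contained in the interior of $H^+$. Then $A$ has an equilibrium measure $\lambda_A$ for the reduced kernel $K$, the set $\Gamma(A)$ has an equilibrium measure $\mu_{\Gamma(A)}$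 for the logarithmic kernel $\log\frac{1}{|p-q|}$ on $\mathbb R^3$ (with the value $+\infty$ for $p=q$), these are related by $\lambda_A(B)=\mu_{\Gamma(A)}(\Gamma(B))$ for all Borel sets $B\subset H^+$, and $$\operatorname{supp}\lambda_A\subset A_+,\qquad \operatorname{supp}\mu_{\Gamma(A)}\subset\Gamma(A_+).$$ -/

import Mathlib

open MeasureTheory

noncomputable section

namespace RevolutionEnergy

/-- Euclidean three-space, with coordinates `(x, y, ζ)`; the axis of revolution is the `y`-axis. -/
abbrev Space : Type := EuclideanSpace ℝ (Fin 3)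

/-- The closed right half-plane `H⁺`, as a subset of `ℂ` (with `z = x + i y`). -/
def rightHalfPlane : Set ℂ := {z | 0 ≤ z.re}

/-- The half-plane point `z = x + i y`, viewed as the point `(x, y, 0)` of three-space. -/
def embed (z : ℂ) : Space := !₂[z.re, z.im, 0]

/-- Rotation of three-space about the `y`-axis through the angle `t`. -/
def rotation (t : ℝ) (p : Space) : Space :=
  !₂[p 0 * Real.cos t - p 2 * Real.sin t, p 1, p 0 * Real.sin t + p 2 * Real.cos t]

/-- The set `Γ(A)` obtained by revolving `A` about the `y`-axis. -/
def revolve (A : Set ℂ) : Set Space :=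
  {p | ∃ z ∈ A, ∃ t ∈ Set.Ico (0 : ℝ) (2 * Real.pi), p = rotation t (embed z)}

/-- The logarithmic kernel `log (1 / |p - q|)`, with value `+∞` for `p = q`. -/
def logKernel (p q : Space) : EReal := ENNReal.log (1 / edist p q)

/-- The reflection `w_* = -u + i v` of `w = u + i v` in the imaginary axis. -/
def reflect (w : ℂ) : ℂ := -(starRingEnd ℂ w)

/-- The reduced kernel `K(z, w) = log (2 / (|z - w| + |z - w_*|))`, with value `+∞` where the
denominator vanishes. -/
def reducedKernel (z w : ℂ) : EReal := ENNReal.log (2 / (edist z w + edist z (reflect w)))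

/-- The integral of an extended-real function, as the integral of its positive part minus the
integral of its negative part. Below, the negative part always has a finite integral: the kernels
are bounded below on compact sets. -/
def extIntegral {X : Type*} [MeasurableSpace X] (f : X → EReal) (μ : Measure X) : EReal :=
  ((∫⁻ x, (f x).toENNReal ∂μ : ENNReal) : EReal) - ((∫⁻ x, (-f x).toENNReal ∂μ : ENNReal) : EReal)

/-- The energy `∬ k(x, y) dμ(x) dμ(y)` of a measure for a kernel `k`. -/
def energy {X : Type*} [MeasurableSpace X] (k : X → X → EReal) (μ : Measure X) : EReal :=
  extIntegral (fun p : X × X => k p.1 p.2) (μ.prod μ)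

/-- The class of Borel probability measures carried by `S`. -/
def probMeasuresOn {X : Type*} [MeasurableSpace X] (S : Set X) : Set (Measure X) :=
  {μ | IsProbabilityMeasure μ ∧ μ Sᶜ = 0}

/-- `μ` is the equilibrium measure of `S` for the kernel `k`: it has finite energy, it minimizes
the energy among the probability measures on `S`, and it is the only minimizer. -/
structure IsEquilibriumMeasure {X : Type*} [MeasurableSpace X] (k : X → X → EReal) (S : Set X)
    (μ : Measure X) : Prop where
  mem : μ ∈ probMeasuresOn S
  energy_lt_top : energy k μ < ⊤
  minimal : ∀ ν ∈ probMeasuresOn S, energy k μ ≤ energy k ν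
  unique : ∀ ν ∈ probMeasuresOn S, energy k ν = energy k μ → ν = μ

/-- The right-most part `A₊` of `A`: the points `x + i y` of `A` for which `x` is the largest
abscissa of a point of `A` at height `y`. -/
def rightMost (A : Set ℂ) : Set ℂ :=
  {z | IsGreatest {x : ℝ | (⟨x, z.im⟩ : ℂ) ∈ A} z.re}

end RevolutionEnergy

end

open RevolutionEnergy

open scoped ENNReal RealInnerProductSpace ComplexConjugate Topology

noncomputable section

namespace RevolutionEnergy

/-! The link between the two energies is a mean value: rotating `q` about the axis moves it at
distance `‖α e^{it} - a‖` from `p`, where `α` is `semiSum (cyl p) (cyl q)` and `‖a‖ ≤ α`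
(`exists_dist_rotation_eq`). The circle average of `log ‖· - a‖` is then `log α`, so the rotational
mean of the logarithmic kernel is the reduced kernel (`lintegral_logRatio_rotation`). Hence pairing
any `ν` with the symmetric measure `lift η` costs the reduced mutual energy of `ν.map cyl` and `η`
(`mutualEnergy_lift`).

The logarithmic energy is strictly positive definite on compactly supported probability measures:
`log (R / r)` is a positive mixture of Gaussians minus constants, and Gaussians have a positive
Fourier transform (`two_mul_mutualEnergy_le`, `eq_of_mutualEnergy_le`). Therefore averaging over
rotations cannot raise the energy (`mutualEnergy_map_cyl_le`), and if `lam` minimizes the reduced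
energy, then `lift lam` minimizes the logarithmic one. Existence of `lam` is weak compactness plus
lower semicontinuity (`exists_minimal_mutualEnergy`). The variational inequality
(`mutualEnergy_self_le_of_minimal`) and strict definiteness give uniqueness in space, which descends
to the half-plane.

For the support, moving a support point of `lam` to the right strictly lowers its potential.
Sweeping nearby mass to the new point would contradict the variational inequality
(`support_subset_rightMost`).

All kernels are replaced by non-negative ones, `log (R / ·)` with `R` large, so that the integrals
live in `ℝ≥0∞`. -/

/-- The mutual energy of two measures for the Gaussian kernel `exp (-s |p - q|²)`. -/
def gaussianEnergy {E : Type*} [NormedAddCommGroup E] [MeasurableSpace E] (s : ℝ)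
    (μ ν : Measure E) : ℝ :=
  ∫ x : E × E, Real.exp (-s * ‖x.1 - x.2‖ ^ 2) ∂(μ.prod ν)

/-! ### Positive definiteness of the Gaussian kernel -/

section Gaussian

set_option linter.unusedSectionVars false

variable {E : Type*} [NormedAddCommGroup E] [InnerProductSpace ℝ E] [FiniteDimensional ℝ E]
  [MeasurableSpace E] [BorelSpace E]

/-- The density of the spectral measure of the Gaussian kernel, up to a constant factor. -/
def spectralDensity (s : ℝ) (v : E) : ℝ := Real.exp (-(1 / (4 * s)) * ‖v‖ ^ 2)

lemma spectralDensity_pos (s : ℝ) (v : E) : 0 < spectralDensity s v := Real.exp_pos _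

lemma continuous_spectralDensity (s : ℝ) : Continuous (spectralDensity (E := E) s) := by
  unfold spectralDensity; fun_prop

lemma integral_spectralDensity_mul_cexp {s : ℝ} (hs : 0 < s) (w : E) :
    ∫ v : E, (spectralDensity s v : ℂ) * Complex.exp (⟪w, v⟫ * Complex.I) =
      ((Real.pi * (4 * s)) ^ ((Module.finrank ℝ E : ℝ) / 2) : ℝ) *
        (Real.exp (-s * ‖w‖ ^ 2) : ℝ) := by
  have hb : 0 < ((1 / (4 * s) : ℝ) : ℂ).re := by simp; positivity
  have h := GaussianFourier.integral_cexp_neg_mul_sq_norm_add (V := E) hb Complex.I w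
  have e1 : ((Real.pi : ℂ) / ((1 / (4 * s) : ℝ) : ℂ)) = ((Real.pi * (4 * s) : ℝ) : ℂ) := by
    push_cast; field_simp
  have e2 : Complex.I ^ 2 * (‖w‖ : ℂ) ^ 2 / (4 * ((1 / (4 * s) : ℝ) : ℂ)) =
      ((-s * ‖w‖ ^ 2 : ℝ) : ℂ) := by
    have : (s : ℂ) ≠ 0 := by exact_mod_cast hs.ne'
    push_cast; rw [Complex.I_sq]; field_simp
  rw [e1, e2] at h
  have e3 : ((Real.pi * (4 * s) : ℝ) : ℂ) ^ ((Module.finrank ℝ E : ℂ) / 2) =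
      (((Real.pi * (4 * s)) ^ ((Module.finrank ℝ E : ℝ) / 2) : ℝ) : ℂ) := by
    rw [Complex.ofReal_cpow (by positivity)]; push_cast; rfl
  rw [e3, ← Complex.ofReal_exp] at h
  rw [← h]
  refine integral_congr_ae (.of_forall fun v => ?_)
  simp only [spectralDensity]
  rw [Complex.ofReal_exp, ← Complex.exp_add]
  push_cast; ring_nf

lemma integrable_spectralDensity {s : ℝ} (hs : 0 < s) :
    Integrable (spectralDensity (E := E) s) := by
  have hb : 0 < ((1 / (4 * s) : ℝ) : ℂ).re := by simp; positivity
  have h := (GaussianFourier.integrable_cexp_neg_mul_sq_norm_add (V := E) hb 0 0).norm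
  refine h.congr (.of_forall fun v => ?_)
  simp only [spectralDensity, Complex.norm_exp]
  congr 1
  simp [← Complex.ofReal_pow]

lemma integral_prod_cexp_inner_sub (μ ν : Measure E) [IsProbabilityMeasure μ]
    [IsProbabilityMeasure ν] (v : E) :
    ∫ x : E × E, Complex.exp (⟪x.1 - x.2, v⟫ * Complex.I) ∂(μ.prod ν) =
      charFun μ v * conj (charFun ν v) := by
  rw [← charFun_neg, charFun_apply, charFun_apply, ← integral_prod_mul]
  refine integral_congr_ae (.of_forall fun x => ?_)
  simp only [← Complex.exp_add, inner_sub_left, inner_neg_right]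
  push_cast; ring_nf

lemma integrable_spectralDensity_mul_charFun {s : ℝ} (hs : 0 < s) (μ ν : Measure E)
    [IsProbabilityMeasure μ] [IsProbabilityMeasure ν] :
    Integrable (fun v => (spectralDensity s v : ℂ) * (charFun μ v * conj (charFun ν v))) := by
  refine (integrable_spectralDensity hs).mono' ?_ (.of_forall fun v => ?_)
  · have := continuous_charFun (μ := μ)
    have := continuous_charFun (μ := ν)
    have := continuous_spectralDensity (E := E) s
    exact Continuous.aestronglyMeasurable (by fun_prop)
  · have h1 := norm_charFun_le_one (μ := μ) v
    have h2 := norm_charFun_le_one (μ := ν) v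
    have h0 : 0 ≤ spectralDensity s v := (spectralDensity_pos _ _).le
    rw [norm_mul, norm_mul, RCLike.norm_conj, Complex.norm_real, Real.norm_of_nonneg h0]
    exact mul_le_of_le_one_right h0 (mul_le_one₀ h1 (norm_nonneg _) h2)

/-- The Gaussian is, up to a constant, the Fourier transform of the positive density
`spectralDensity s`; Fubini turns the double integral over points into one over frequencies. -/
lemma integral_spectralDensity_mul_charFun {s : ℝ} (hs : 0 < s) (μ ν : Measure E)
    [IsProbabilityMeasure μ] [IsProbabilityMeasure ν] :
    ∫ v, (spectralDensity s v : ℂ) * (charFun μ v * conj (charFun ν v)) =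
      ((Real.pi * (4 * s)) ^ ((Module.finrank ℝ E : ℝ) / 2) : ℝ) *
        (gaussianEnergy s μ ν : ℝ) := by
  simp_rw [← integral_prod_cexp_inner_sub, ← integral_const_mul]
  rw [integral_integral_swap]
  · simp_rw [integral_spectralDensity_mul_cexp hs, integral_const_mul, gaussianEnergy,
      integral_complex_ofReal]
  · have : Integrable (fun p : E × (E × E) => spectralDensity s p.1)
        (volume.prod (μ.prod ν)) := (integrable_spectralDensity hs).comp_fst _
    refine this.mono' ?_ (.of_forall fun p => ?_)
    · have := continuous_spectralDensity (E := E) s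
      exact Continuous.aestronglyMeasurable (by fun_prop)
    · have h0 : 0 ≤ spectralDensity s p.1 := (spectralDensity_pos _ _).le
      simp [Function.uncurry, Complex.norm_exp_ofReal_mul_I, abs_of_nonneg h0]

/-- Expanding the square of the norm gives four products of characteristic functions, each
integrating to a mutual energy. Positivity, and its strict form, can be read off the left side. -/
lemma gaussianEnergy_defect {s : ℝ} (hs : 0 < s) (μ ν : Measure E)
    [IsProbabilityMeasure μ] [IsProbabilityMeasure ν] :
    ∫ v, spectralDensity s v * ‖charFun μ v - charFun ν v‖ ^ 2 =
      (Real.pi * (4 * s)) ^ ((Module.finrank ℝ E : ℝ) / 2) *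
        (gaussianEnergy s μ μ + gaussianEnergy s ν ν
          - gaussianEnergy s μ ν - gaussianEnergy s ν μ) := by
  have h := fun (μ ν : Measure E) (_ : IsProbabilityMeasure μ) (_ : IsProbabilityMeasure ν) =>
    integral_spectralDensity_mul_charFun hs μ ν
  have i := fun (μ ν : Measure E) (_ : IsProbabilityMeasure μ) (_ : IsProbabilityMeasure ν) =>
    integrable_spectralDensity_mul_charFun hs μ ν
  rw [← Complex.ofReal_inj, ← integral_complex_ofReal]
  push_cast
  rw [mul_sub, mul_sub, mul_add]
  have h1 := h μ μ ‹_› ‹_›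
  have h2 := h ν ν ‹_› ‹_›
  have h3 := h μ ν ‹_› ‹_›
  have h4 := h ν μ ‹_› ‹_›
  have i1 := i μ μ ‹_› ‹_›
  have i2 := i ν ν ‹_› ‹_›
  have i3 := i μ ν ‹_› ‹_›
  have i4 := i ν μ ‹_› ‹_›
  rw [← h1, ← h2, ← h3, ← h4, ← integral_add i1 i2, ← integral_sub (by exact i1.add i2) i3,
    ← integral_sub (by exact (i1.add i2).sub i3) i4]
  refine integral_congr_ae (.of_forall fun v => ?_)
  simp only
  rw [← Complex.mul_conj', map_sub]
  ring

lemma gaussianEnergy_add_le {s : ℝ} (hs : 0 < s) (μ ν : Measure E)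
    [IsProbabilityMeasure μ] [IsProbabilityMeasure ν] :
    gaussianEnergy s μ ν + gaussianEnergy s ν μ ≤
      gaussianEnergy s μ μ + gaussianEnergy s ν ν := by
  have h := gaussianEnergy_defect hs μ ν
  have h0 : 0 ≤ ∫ v, spectralDensity s v * ‖charFun μ v - charFun ν v‖ ^ 2 :=
    integral_nonneg fun v => mul_nonneg (spectralDensity_pos _ _).le (by positivity)
  rw [h] at h0
  have := nonneg_of_mul_nonneg_right h0 (by positivity)
  linarith

/-- The spectral density vanishes nowhere and characteristic functions are continuous, so a zero
defect makes them agree at every frequency. -/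
lemma eq_of_gaussianEnergy_le {s : ℝ} (hs : 0 < s) {μ ν : Measure E}
    [IsProbabilityMeasure μ] [IsProbabilityMeasure ν]
    (hle : gaussianEnergy s μ μ + gaussianEnergy s ν ν ≤
      gaussianEnergy s μ ν + gaussianEnergy s ν μ) : μ = ν := by
  have h := gaussianEnergy_defect hs μ ν
  have hz : ∫ v, spectralDensity s v * ‖charFun μ v - charFun ν v‖ ^ 2 = 0 := by
    have hd : gaussianEnergy s μ μ + gaussianEnergy s ν ν
        - gaussianEnergy s μ ν - gaussianEnergy s ν μ = 0 := by
      linarith [gaussianEnergy_add_le hs μ ν]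
    rw [h, hd, mul_zero]
  have c1 := continuous_charFun (μ := μ)
  have c2 := continuous_charFun (μ := ν)
  have c3 := continuous_spectralDensity (E := E) s
  have c4 : Continuous fun v => spectralDensity s v * ‖charFun μ v - charFun ν v‖ ^ 2 :=
    c3.mul ((c1.sub c2).norm.pow 2)
  rw [integral_eq_zero_iff_of_nonneg
    (fun v => mul_nonneg (spectralDensity_pos _ _).le (by positivity))] at hz
  · have := (Continuous.ae_eq_iff_eq (volume : Measure E) c4 continuous_const).1 hz
    refine Measure.ext_of_charFun (funext fun v => ?_)
    have hv : spectralDensity s v * ‖charFun μ v - charFun ν v‖ ^ 2 = 0 := congrFun this v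
    have hp : spectralDensity s v ≠ 0 := (spectralDensity_pos _ _).ne'
    simp only [mul_eq_zero, hp, false_or] at hv
    simpa [sub_eq_zero] using hv
  -- Two characteristic functions differ by at most 2, whence the constant 4.
  · refine (((integrable_spectralDensity hs).mul_const 4)).mono'
      c4.aestronglyMeasurable (.of_forall fun v => ?_)
    have h1 := norm_charFun_le_one (μ := μ) v
    have h2 := norm_charFun_le_one (μ := ν) v
    have h3 := norm_sub_le (charFun μ v) (charFun ν v)
    have h0 : 0 ≤ spectralDensity s v := (spectralDensity_pos _ _).le
    rw [Real.norm_of_nonneg (by positivity)]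
    refine mul_le_mul_of_nonneg_left ?_ h0
    nlinarith [norm_nonneg (charFun μ v - charFun ν v)]

end Gaussian

/-! ### The logarithm as a mixture of Gaussians -/

/-- The positive part of `log (R / r)`, with value `∞` for `r ≤ 0`. -/
def logRatio (R r : ℝ) : ℝ≥0∞ := (ENNReal.log (ENNReal.ofReal R / ENNReal.ofReal r)).toENNReal

lemma continuous_logRatio (R : ℝ) : Continuous (logRatio R) := by
  unfold logRatio
  refine EReal.continuous_toENNReal.comp (ENNReal.continuous_log.comp ?_)
  simp_rw [div_eq_mul_inv]
  exact (ENNReal.continuous_const_mul ENNReal.ofReal_ne_top).comp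
    (continuous_inv.comp ENNReal.continuous_ofReal)

lemma logRatio_zero {R : ℝ} (hR : 0 < R) : logRatio R 0 = ⊤ := by
  simp [logRatio, ENNReal.div_zero, hR]

lemma logRatio_of_pos {R r : ℝ} (hR : 0 < R) (hr : 0 < r) :
    logRatio R r = ENNReal.ofReal (Real.log R - Real.log r) := by
  rw [logRatio, ← ENNReal.ofReal_div_of_pos hr, ENNReal.log_ofReal_of_pos (by positivity),
    Real.log_div hR.ne' hr.ne']
  rfl

lemma logRatio_anti (R : ℝ) : Antitone (logRatio R) := by
  intro r r' h
  unfold logRatio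
  refine EReal.toENNReal_le_toENNReal (ENNReal.log_monotone ?_)
  gcongr

/-- Strictness needs `r' ≤ R`: beyond `R` the positive part is constantly zero. -/
lemma logRatio_lt {R r r' : ℝ} (hr : 0 ≤ r) (h : r < r') (hR : r' ≤ R) :
    logRatio R r' < logRatio R r := by
  have hr' : 0 < r' := hr.trans_lt h
  have hR' : 0 < R := hr'.trans_le hR
  rcases hr.eq_or_lt with rfl | hr
  · rw [logRatio_zero hR', logRatio_of_pos hR' hr']; exact ENNReal.ofReal_lt_top
  · rw [logRatio_of_pos hR' hr', logRatio_of_pos hR' hr]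
    have h1 := Real.log_lt_log hr h
    have h2 := Real.log_le_log hr' hR
    exact (ENNReal.ofReal_lt_ofReal_iff (by linarith)).2 (by linarith)

lemma lintegral_exp_neg_mul_Ioi {u : ℝ} (hu : 0 < u) :
    ∫⁻ s in Set.Ioi (0 : ℝ), ENNReal.ofReal (Real.exp (-u * s)) = ENNReal.ofReal (1 / u) := by
  rw [← ofReal_integral_eq_lintegral_ofReal (integrableOn_exp_mul_Ioi (by linarith) 0)
    (.of_forall fun s => (Real.exp_pos _).le), integral_exp_mul_Ioi (by linarith)]
  congr 1; simp

/-- Prepares Frullani's integral: with the quotient written as an integral over `u`, Tonelli leaves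
the integral of `1 / u`. -/
lemma ofReal_exp_sub_exp_div {a b s : ℝ} (hab : a ≤ b) (hs : 0 < s) :
    ENNReal.ofReal ((Real.exp (-s * a) - Real.exp (-s * b)) / s) =
      ∫⁻ u in Set.Ioc a b, ENNReal.ofReal (Real.exp (-u * s)) := by
  have hc : Continuous fun u : ℝ => Real.exp (-u * s) := by fun_prop
  rw [← ofReal_integral_eq_lintegral_ofReal
    (hc.integrableOn_Ioc) (.of_forall fun s => (Real.exp_pos _).le),
    ← intervalIntegral.integral_of_le hab]
  congr 1
  have : ∀ u ∈ Set.uIcc a b,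
      HasDerivAt (fun u => -Real.exp (-u * s) / s) (Real.exp (-u * s)) u := by
    intro u _
    have h := (((hasDerivAt_id u).neg.mul_const s).exp.neg).div_const s
    refine h.congr_deriv ?_
    field_simp
    simp [mul_comm]
  rw [intervalIntegral.integral_eq_sub_of_hasDerivAt this (hc.intervalIntegrable _ _)]
  ring_nf

/-- Frullani's integral for the exponential function. -/
lemma lintegral_exp_sub_exp_div {a b : ℝ} (ha : 0 < a) (hab : a ≤ b) :
    ∫⁻ s in Set.Ioi (0 : ℝ), ENNReal.ofReal ((Real.exp (-s * a) - Real.exp (-s * b)) / s) =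
      ENNReal.ofReal (Real.log b - Real.log a) := by
  rw [setLIntegral_congr_fun measurableSet_Ioi
    (fun s hs => ofReal_exp_sub_exp_div hab hs)]
  rw [lintegral_lintegral_swap (by fun_prop)]
  rw [setLIntegral_congr_fun measurableSet_Ioc
    (fun u hu => lintegral_exp_neg_mul_Ioi (ha.trans hu.1))]
  have hi : IntervalIntegrable (fun u : ℝ => 1 / u) volume a b :=
    intervalIntegral.intervalIntegrable_one_div (fun u hu => by
      rw [Set.uIcc_of_le hab] at hu; exact (ha.trans_le hu.1).ne') continuousOn_id
  rw [← ofReal_integral_eq_lintegral_ofReal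
      ((intervalIntegrable_iff_integrableOn_Ioc_of_le hab).1 hi),
    ← intervalIntegral.integral_of_le hab, integral_one_div_of_pos ha (ha.trans_le hab),
    Real.log_div (ha.trans_le hab).ne' ha.ne']
  filter_upwards [ae_restrict_mem measurableSet_Ioc] with u hu
  exact one_div_nonneg.2 (ha.trans hu.1).le

/-- The Gaussian representation of the logarithm. -/
lemma logRatio_eq_lintegral {R r : ℝ} (hR : 0 < R) (hr : 0 ≤ r) (hrR : r ≤ R) :
    logRatio R r = ∫⁻ s in Set.Ioi (0 : ℝ),
      ENNReal.ofReal ((Real.exp (-s * r ^ 2) - Real.exp (-s * R ^ 2)) / (2 * s)) := by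
  have half : ∀ a b s : ℝ, ENNReal.ofReal ((Real.exp (-s * a) - Real.exp (-s * b)) / (2 * s)) =
      ENNReal.ofReal (1 / 2) * ENNReal.ofReal ((Real.exp (-s * a) - Real.exp (-s * b)) / s) := by
    intro a b s
    rw [← ENNReal.ofReal_mul (by norm_num)]; congr 1; field_simp
  have key : ∀ r, 0 < r → r ≤ R → logRatio R r = ∫⁻ s in Set.Ioi (0 : ℝ),
      ENNReal.ofReal ((Real.exp (-s * r ^ 2) - Real.exp (-s * R ^ 2)) / (2 * s)) := by
    intro r hr hrR
    simp_rw [half]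
    rw [lintegral_const_mul' _ _ ENNReal.ofReal_ne_top,
      lintegral_exp_sub_exp_div (by positivity) (by gcongr),
      ← ENNReal.ofReal_mul (by norm_num), logRatio_of_pos hR hr, Real.log_pow, Real.log_pow]
    congr 1; push_cast; ring
  rcases hr.eq_or_lt with rfl | hr
  -- At `r = 0` the integral must be shown infinite: it dominates the integrals for all small `r >
  -- 0`, whose values tend to `logRatio R 0`.
  · refine le_antisymm ?_ (by rw [logRatio_zero hR]; exact le_top)
    have ht : Filter.Tendsto (logRatio R) (nhdsWithin 0 (Set.Ioi 0)) (nhds (logRatio R 0)) :=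
      ((continuous_logRatio R).tendsto 0).mono_left nhdsWithin_le_nhds
    refine le_of_tendsto ht ?_
    filter_upwards [Ioc_mem_nhdsGT hR] with r hr
    rw [key r hr.1 hr.2]
    refine setLIntegral_mono' measurableSet_Ioi fun s hs => ENNReal.ofReal_le_ofReal ?_
    have hs : 0 < s := hs
    refine div_le_div_of_nonneg_right (sub_le_sub_right (Real.exp_le_exp.2 ?_) _) (by positivity)
    have : 0 ≤ s * r ^ 2 := by positivity
    nlinarith
  · exact key r hr hrR

/-- The mutual energy `∬ k(x, y) dν(y) dμ(x)` for a non-negative kernel. -/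
def mutualEnergy {X Y : Type*} [MeasurableSpace X] [MeasurableSpace Y] (k : X → Y → ℝ≥0∞)
    (μ : Measure X) (ν : Measure Y) : ℝ≥0∞ := ∫⁻ x, ∫⁻ y, k x y ∂ν ∂μ

/-! ### Strict positive definiteness of the logarithmic energy -/

section LogEnergy

variable {E : Type*} [NormedAddCommGroup E] [InnerProductSpace ℝ E] [FiniteDimensional ℝ E]
  [MeasurableSpace E] [BorelSpace E]

set_option linter.unusedSectionVars false

/-- The non-negative kernel `log (R / |p - q|)` on a set of diameter at most `R`. -/
def logRatioKernel (R : ℝ) (p q : E) : ℝ≥0∞ := logRatio R (dist p q)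

lemma measurable_logRatioKernel (R : ℝ) :
    Measurable (fun x : E × E => logRatioKernel R x.1 x.2) :=
  ((continuous_logRatio R).comp continuous_dist).measurable

lemma ae_prod_dist_le {R : ℝ} {μ ν : Measure E} [SFinite μ] [SFinite ν]
    (hμ : ∀ᵐ p ∂μ, ‖p‖ ≤ R / 2) (hν : ∀ᵐ p ∂ν, ‖p‖ ≤ R / 2) :
    ∀ᵐ x ∂(μ.prod ν), dist x.1 x.2 ≤ R := by
  have h1 := Measure.quasiMeasurePreserving_fst (μ := μ) (ν := ν) |>.ae hμ
  have h2 := Measure.quasiMeasurePreserving_snd (μ := μ) (ν := ν) |>.ae hν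
  filter_upwards [h1, h2] with x h1 h2
  rw [dist_eq_norm]
  exact (norm_sub_le _ _).trans (by linarith)

lemma integrable_gaussian (s : ℝ) (hs : 0 ≤ s) (μ ν : Measure E) [IsProbabilityMeasure μ]
    [IsProbabilityMeasure ν] :
    Integrable (fun x : E × E => Real.exp (-s * ‖x.1 - x.2‖ ^ 2)) (μ.prod ν) := by
  refine (integrable_const 1).mono' (Continuous.aestronglyMeasurable (by fun_prop))
    (.of_forall fun x => ?_)
  rw [Real.norm_of_nonneg (Real.exp_pos _).le, Real.exp_le_one_iff]
  have : 0 ≤ s * ‖x.1 - x.2‖ ^ 2 := by positivity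
  linarith

/-- Both measures live in the ball of radius `R / 2`, so distances are at most `R` and the Gaussian
integrand is non-negative, which permits Tonelli. Total mass one makes the subtracted term a
constant independent of the measures. -/
lemma mutualEnergy_eq_lintegral {R : ℝ} (hR : 0 < R) {μ ν : Measure E} [IsProbabilityMeasure μ]
    [IsProbabilityMeasure ν] (hμ : ∀ᵐ p ∂μ, ‖p‖ ≤ R / 2) (hν : ∀ᵐ p ∂ν, ‖p‖ ≤ R / 2) :
    mutualEnergy (logRatioKernel R) μ ν = ∫⁻ s in Set.Ioi (0 : ℝ),
      ENNReal.ofReal ((gaussianEnergy s μ ν - Real.exp (-s * R ^ 2)) / (2 * s)) := by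
  have hd := ae_prod_dist_le hμ hν
  rw [mutualEnergy, ← lintegral_prod _ (measurable_logRatioKernel R).aemeasurable]
  have h1 : ∀ᵐ x ∂(μ.prod ν), logRatioKernel R x.1 x.2 = ∫⁻ s in Set.Ioi (0 : ℝ),
      ENNReal.ofReal ((Real.exp (-s * ‖x.1 - x.2‖ ^ 2) - Real.exp (-s * R ^ 2)) / (2 * s)) := by
    filter_upwards [hd] with x hx
    rw [logRatioKernel, logRatio_eq_lintegral hR dist_nonneg hx, dist_eq_norm]
  rw [lintegral_congr_ae h1, lintegral_lintegral_swap (Measurable.aemeasurable (by fun_prop))]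
  refine setLIntegral_congr_fun measurableSet_Ioi fun s hs => ?_
  have hs : 0 < s := hs
  have hi := integrable_gaussian s hs.le μ ν
  have hi' : Integrable (fun x : E × E =>
      (Real.exp (-s * ‖x.1 - x.2‖ ^ 2) - Real.exp (-s * R ^ 2)) / (2 * s)) (μ.prod ν) :=
    (hi.sub (integrable_const _)).div_const _
  rw [← ofReal_integral_eq_lintegral_ofReal hi']
  · congr 1
    rw [integral_div, integral_sub hi (integrable_const _)]
    simp [gaussianEnergy]
  · filter_upwards [hd] with x hx
    rw [dist_eq_norm] at hx
    refine div_nonneg (sub_nonneg.2 (Real.exp_le_exp.2 ?_)) (by positivity)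
    have : ‖x.1 - x.2‖ ^ 2 ≤ R ^ 2 := by gcongr
    nlinarith

lemma gaussianEnergy_sub_nonneg {R s : ℝ} (hs : 0 < s) {μ ν : Measure E}
    [IsProbabilityMeasure μ] [IsProbabilityMeasure ν]
    (hμ : ∀ᵐ p ∂μ, ‖p‖ ≤ R / 2) (hν : ∀ᵐ p ∂ν, ‖p‖ ≤ R / 2) :
    0 ≤ (gaussianEnergy s μ ν - Real.exp (-s * R ^ 2)) / (2 * s) := by
  refine div_nonneg (sub_nonneg.2 ?_) (by positivity)
  have hi := integrable_gaussian s hs.le μ ν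
  have h0 : Real.exp (-s * R ^ 2) = ∫ x : E × E, Real.exp (-s * R ^ 2) ∂(μ.prod ν) := by simp
  rw [h0]
  refine integral_mono_ae (integrable_const _) hi ?_
  filter_upwards [ae_prod_dist_le hμ hν] with x hx
  rw [dist_eq_norm] at hx
  refine Real.exp_le_exp.2 ?_
  have : ‖x.1 - x.2‖ ^ 2 ≤ R ^ 2 := by gcongr
  nlinarith

lemma gaussianEnergy_comm (s : ℝ) (μ ν : Measure E) [IsProbabilityMeasure μ]
    [IsProbabilityMeasure ν] : gaussianEnergy s μ ν = gaussianEnergy s ν μ := by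
  unfold gaussianEnergy
  rw [← integral_prod_swap]
  simp [norm_sub_rev]

lemma measurable_gaussianEnergy (μ ν : Measure E) [IsProbabilityMeasure μ]
    [IsProbabilityMeasure ν] : Measurable fun s : ℝ => gaussianEnergy s μ ν := by
  unfold gaussianEnergy
  refine StronglyMeasurable.measurable ?_
  refine StronglyMeasurable.integral_prod_right (f := fun (s : ℝ) (x : E × E) =>
    Real.exp (-s * ‖x.1 - x.2‖ ^ 2)) (ν := μ.prod ν) ?_
  exact Continuous.stronglyMeasurable (by fun_prop)

/-- The constant `exp (-s R²)` occurs twice on each side and cancels, leaving the Gaussian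
inequality at the single parameter `s`. -/
lemma two_mul_gaussianEnergy_sub_le {R s : ℝ} (hs : 0 < s) {μ ν : Measure E}
    [IsProbabilityMeasure μ] [IsProbabilityMeasure ν]
    (hμ : ∀ᵐ p ∂μ, ‖p‖ ≤ R / 2) (hν : ∀ᵐ p ∂ν, ‖p‖ ≤ R / 2) :
    2 * ENNReal.ofReal ((gaussianEnergy s μ ν - Real.exp (-s * R ^ 2)) / (2 * s)) ≤
      ENNReal.ofReal ((gaussianEnergy s μ μ - Real.exp (-s * R ^ 2)) / (2 * s)) +
      ENNReal.ofReal ((gaussianEnergy s ν ν - Real.exp (-s * R ^ 2)) / (2 * s)) ∧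
    (μ ≠ ν → 2 * ENNReal.ofReal ((gaussianEnergy s μ ν - Real.exp (-s * R ^ 2)) / (2 * s)) <
      ENNReal.ofReal ((gaussianEnergy s μ μ - Real.exp (-s * R ^ 2)) / (2 * s)) +
      ENNReal.ofReal ((gaussianEnergy s ν ν - Real.exp (-s * R ^ 2)) / (2 * s))) := by
  have h2 : (2 : ℝ≥0∞) = ENNReal.ofReal 2 := by simp
  have n1 := gaussianEnergy_sub_nonneg hs hμ hμ
  have n2 := gaussianEnergy_sub_nonneg hs hν hν
  have n3 := gaussianEnergy_sub_nonneg hs hμ hν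
  rw [h2, ← ENNReal.ofReal_mul (by norm_num), ← ENNReal.ofReal_add n1 n2]
  have e1 : 2 * ((gaussianEnergy s μ ν - Real.exp (-s * R ^ 2)) / (2 * s)) =
      (2 * gaussianEnergy s μ ν - 2 * Real.exp (-s * R ^ 2)) / (2 * s) := by ring
  have e2 : (gaussianEnergy s μ μ - Real.exp (-s * R ^ 2)) / (2 * s) +
      (gaussianEnergy s ν ν - Real.exp (-s * R ^ 2)) / (2 * s) =
      (gaussianEnergy s μ μ + gaussianEnergy s ν ν - 2 * Real.exp (-s * R ^ 2)) / (2 * s) := by ring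
  have hc := gaussianEnergy_comm s μ ν
  constructor
  · refine ENNReal.ofReal_le_ofReal ?_
    rw [e1, e2]
    have := gaussianEnergy_add_le hs μ ν
    refine div_le_div_of_nonneg_right ?_ (by positivity)
    linarith
  · intro hne
    refine (ENNReal.ofReal_lt_ofReal_iff_of_nonneg (by positivity)).2 ?_
    rw [e1, e2]
    refine div_lt_div_of_pos_right ?_ (by positivity)
    by_contra hcon
    exact hne (eq_of_gaussianEnergy_le hs (by linarith))

lemma mutualEnergy_comm {X : Type*} [MeasurableSpace X] {k : X → X → ℝ≥0∞}
    (hk : Measurable (fun x : X × X => k x.1 x.2)) (hsymm : ∀ x y, k x y = k y x)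
    (μ ν : Measure X) [SFinite μ] [SFinite ν] : mutualEnergy k μ ν = mutualEnergy k ν μ := by
  unfold mutualEnergy
  rw [lintegral_lintegral_swap hk.aemeasurable]
  simp_rw [hsymm]

lemma two_mul_mutualEnergy_le {R : ℝ} (hR : 0 < R) {μ ν : Measure E} [IsProbabilityMeasure μ]
    [IsProbabilityMeasure ν] (hμ : ∀ᵐ p ∂μ, ‖p‖ ≤ R / 2) (hν : ∀ᵐ p ∂ν, ‖p‖ ≤ R / 2) :
    2 * mutualEnergy (logRatioKernel R) μ ν ≤
      mutualEnergy (logRatioKernel R) μ μ + mutualEnergy (logRatioKernel R) ν ν := by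
  have m1 := measurable_gaussianEnergy μ μ
  have m3 := measurable_gaussianEnergy μ ν
  rw [mutualEnergy_eq_lintegral hR hμ hν, mutualEnergy_eq_lintegral hR hμ hμ,
    mutualEnergy_eq_lintegral hR hν hν, ← lintegral_add_left (by fun_prop),
    ← lintegral_const_mul _ (by fun_prop)]
  exact setLIntegral_mono' measurableSet_Ioi fun s hs =>
    (two_mul_gaussianEnergy_sub_le hs hμ hν).1

/-- The logarithmic energy is strictly positive definite on differences of probability measures. -/
lemma eq_of_mutualEnergy_le {R : ℝ} (hR : 0 < R) {μ ν : Measure E} [IsProbabilityMeasure μ]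
    [IsProbabilityMeasure ν] (hμ : ∀ᵐ p ∂μ, ‖p‖ ≤ R / 2) (hν : ∀ᵐ p ∂ν, ‖p‖ ≤ R / 2)
    (hfin : mutualEnergy (logRatioKernel R) μ ν ≠ ⊤)
    (hle : mutualEnergy (logRatioKernel R) μ μ + mutualEnergy (logRatioKernel R) ν ν ≤
      2 * mutualEnergy (logRatioKernel R) μ ν) : μ = ν := by
  by_contra hne
  refine hle.not_gt ?_
  have hfin' := ENNReal.mul_ne_top ENNReal.ofNat_ne_top hfin (a := 2)
  have m1 := measurable_gaussianEnergy μ μ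
  have m2 := measurable_gaussianEnergy ν ν
  have m3 := measurable_gaussianEnergy μ ν
  rw [mutualEnergy_eq_lintegral hR hμ hν, ← lintegral_const_mul _ (by fun_prop)] at hfin' ⊢
  rw [mutualEnergy_eq_lintegral hR hμ hμ,
    mutualEnergy_eq_lintegral hR hν hν, ← lintegral_add_left (by fun_prop)]
  -- The inequality is strict at every `s > 0`; finiteness of the smaller integral keeps it strict
  -- after integration.
  refine lintegral_strict_mono ?_ (by fun_prop) hfin' ?_
  · simp [Measure.restrict_eq_zero]
  · filter_upwards [ae_restrict_mem measurableSet_Ioi] with s hs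
    exact (two_mul_gaussianEnergy_sub_le hs hμ hν).2 hne

end LogEnergy

/-! ### Geometry of rotation orbits -/

/-- The half-plane point on whose orbit under rotation `p` lies. -/
def cyl (p : Space) : ℂ := ⟨√(p 0 ^ 2 + p 2 ^ 2), p 1⟩

/-- Half the sum of the distances from `z` to `w` and to its reflection. -/
def semiSum (z w : ℂ) : ℝ := (dist z w + dist z (reflect w)) / 2

lemma dist_sq_eq (p q : Space) :
    dist p q ^ 2 = (p 0 - q 0) ^ 2 + (p 1 - q 1) ^ 2 + (p 2 - q 2) ^ 2 := by
  rw [EuclideanSpace.dist_eq, Real.sq_sqrt (by positivity), Fin.sum_univ_three]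
  simp [Real.dist_eq, sq_abs]

lemma norm_sq_eq (p : Space) : ‖p‖ ^ 2 = p 0 ^ 2 + p 1 ^ 2 + p 2 ^ 2 := by
  rw [EuclideanSpace.norm_eq, Real.sq_sqrt (by positivity), Fin.sum_univ_three]
  simp

@[simp] lemma rotation_apply_zero (t : ℝ) (p : Space) :
    rotation t p 0 = p 0 * Real.cos t - p 2 * Real.sin t := rfl

@[simp] lemma rotation_apply_one (t : ℝ) (p : Space) : rotation t p 1 = p 1 := rfl

@[simp] lemma rotation_apply_two (t : ℝ) (p : Space) :
    rotation t p 2 = p 0 * Real.sin t + p 2 * Real.cos t := rfl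

@[simp] lemma embed_apply_zero (z : ℂ) : embed z 0 = z.re := rfl

@[simp] lemma embed_apply_one (z : ℂ) : embed z 1 = z.im := rfl

@[simp] lemma embed_apply_two (z : ℂ) : embed z 2 = 0 := rfl

lemma dist_rotation_rotation (t : ℝ) (p q : Space) :
    dist (rotation t p) (rotation t q) = dist p q := by
  rw [← sq_eq_sq₀ dist_nonneg dist_nonneg, dist_sq_eq, dist_sq_eq]
  simp only [rotation_apply_zero, rotation_apply_one, rotation_apply_two]
  linear_combination ((p 0 - q 0) ^ 2 + (p 2 - q 2) ^ 2) * Real.sin_sq_add_cos_sq t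

lemma norm_rotation (t : ℝ) (p : Space) : ‖rotation t p‖ = ‖p‖ := by
  rw [← sq_eq_sq₀ (norm_nonneg _) (norm_nonneg _), norm_sq_eq, norm_sq_eq]
  simp only [rotation_apply_zero, rotation_apply_one, rotation_apply_two]
  linear_combination (p 0 ^ 2 + p 2 ^ 2) * Real.sin_sq_add_cos_sq t

lemma norm_embed (z : ℂ) : ‖embed z‖ = ‖z‖ := by
  rw [← sq_eq_sq₀ (norm_nonneg _) (norm_nonneg _), norm_sq_eq, Complex.sq_norm,
    Complex.normSq_apply]
  simp; ring

lemma norm_cyl (p : Space) : ‖cyl p‖ = ‖p‖ := by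
  rw [← sq_eq_sq₀ (norm_nonneg _) (norm_nonneg _), norm_sq_eq, Complex.sq_norm,
    Complex.normSq_apply]
  simp only [cyl]
  rw [Real.mul_self_sqrt (by positivity)]; ring

lemma cyl_rotation (t : ℝ) (p : Space) : cyl (rotation t p) = cyl p := by
  simp only [cyl, rotation_apply_zero, rotation_apply_one, rotation_apply_two]
  congr 2
  linear_combination (p 0 ^ 2 + p 2 ^ 2) * Real.sin_sq_add_cos_sq t

lemma cyl_embed {z : ℂ} (hz : 0 ≤ z.re) : cyl (embed z) = z := by
  apply Complex.ext <;> simp [cyl, Real.sqrt_sq hz]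

lemma continuous_cyl : Continuous cyl := by
  have : cyl = fun p : Space => ((√(p 0 ^ 2 + p 2 ^ 2) : ℝ) : ℂ) + (p 1 : ℝ) * Complex.I := by
    funext p; apply Complex.ext <;> simp [cyl]
  rw [this]; fun_prop

lemma continuous_rotation : Continuous fun x : Space × ℝ => rotation x.2 x.1 := by
  refine (PiLp.continuous_toLp 2 _).comp (continuous_pi fun i => ?_)
  fin_cases i <;> simp <;> fun_prop

lemma continuous_embed : Continuous embed := by
  refine (PiLp.continuous_toLp 2 _).comp (continuous_pi fun i => ?_)
  fin_cases i <;> simp <;> fun_prop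

lemma continuous_reflect : Continuous reflect := by
  unfold reflect; fun_prop

lemma continuous_semiSum : Continuous fun x : ℂ × ℂ => semiSum x.1 x.2 := by
  have := continuous_reflect
  unfold semiSum; fun_prop

lemma semiSum_nonneg (z w : ℂ) : 0 ≤ semiSum z w := by unfold semiSum; positivity

lemma reflect_re (w : ℂ) : (reflect w).re = -w.re := by simp [reflect]

lemma reflect_im (w : ℂ) : (reflect w).im = w.im := by simp [reflect]

lemma complex_dist_sq (z w : ℂ) : dist z w ^ 2 = (z.re - w.re) ^ 2 + (z.im - w.im) ^ 2 := by
  rw [Complex.dist_eq, Complex.sq_norm, Complex.normSq_apply]; simp; ring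

lemma semiSum_comm (z w : ℂ) : semiSum z w = semiSum w z := by
  have : dist z (reflect w) = dist w (reflect z) := by
    rw [← sq_eq_sq₀ dist_nonneg dist_nonneg, complex_dist_sq, complex_dist_sq]
    simp only [reflect_re, reflect_im]; ring
  rw [semiSum, semiSum, this, dist_comm]

lemma semiSum_le {R : ℝ} {z w : ℂ} (hz : ‖z‖ ≤ R / 2) (hw : ‖w‖ ≤ R / 2) : semiSum z w ≤ R := by
  have h1 := norm_sub_le z w
  have h2 := norm_sub_le z (reflect w)
  have h3 : ‖reflect w‖ = ‖w‖ := by simp [reflect]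
  rw [h3] at h2
  rw [semiSum, dist_eq_norm, dist_eq_norm]
  linarith

lemma exists_rotation_embed_cyl (p : Space) :
    ∃ t ∈ Set.Ico (0 : ℝ) (2 * Real.pi), p = rotation t (embed (cyl p)) := by
  set P : ℂ := ⟨p 0, p 2⟩
  have hn : ‖P‖ = √(p 0 ^ 2 + p 2 ^ 2) := by
    rw [Complex.norm_eq_sqrt_sq_add_sq]
  refine ⟨toIcoMod Real.two_pi_pos 0 (Complex.arg P), ?_, ?_⟩
  · simpa using toIcoMod_mem_Ico Real.two_pi_pos 0 (Complex.arg P)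
  · have hc : Real.cos (toIcoMod Real.two_pi_pos 0 (Complex.arg P)) = Real.cos P.arg := by
      simp only [toIcoMod, zsmul_eq_mul, Real.cos_sub_int_mul_two_pi]
    have hs : Real.sin (toIcoMod Real.two_pi_pos 0 (Complex.arg P)) = Real.sin P.arg := by
      simp only [toIcoMod, zsmul_eq_mul, Real.sin_sub_int_mul_two_pi]
    have h1 : p 0 = √(p 0 ^ 2 + p 2 ^ 2) * Real.cos P.arg := by
      rw [← hn, Complex.norm_mul_cos_arg]
    have h2 : p 2 = √(p 0 ^ 2 + p 2 ^ 2) * Real.sin P.arg := by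
      rw [← hn, Complex.norm_mul_sin_arg]
    ext i
    fin_cases i
    · simpa [hc, cyl] using h1
    · simp [cyl]
    · simpa [hs, cyl] using h2

lemma revolve_eq_preimage {B : Set ℂ} (hB : B ⊆ rightHalfPlane) : revolve B = cyl ⁻¹' B := by
  ext p
  constructor
  · rintro ⟨z, hz, t, -, rfl⟩
    rw [Set.mem_preimage, cyl_rotation, cyl_embed (hB hz)]
    exact hz
  · intro hp
    obtain ⟨t, ht, h⟩ := exists_rotation_embed_cyl p
    exact ⟨cyl p, hp, t, ht, h⟩

/-- Along an orbit of the rotations the distance to a fixed point is the distance of a fixed point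
of the plane to a point of the circle of radius `semiSum`. -/
lemma exists_dist_rotation_eq (p q : Space) :
    ∃ a : ℂ, ‖a‖ ≤ semiSum (cyl p) (cyl q) ∧
      ∀ t, dist p (rotation t q) = ‖circleMap 0 (semiSum (cyl p) (cyl q)) t - a‖ := by
  set α := semiSum (cyl p) (cyl q) with hα
  set x := √(p 0 ^ 2 + p 2 ^ 2) with hx
  set u := √(q 0 ^ 2 + q 2 ^ 2) with hu
  have hx2 : x ^ 2 = p 0 ^ 2 + p 2 ^ 2 := Real.sq_sqrt (by positivity)
  have hu2 : u ^ 2 = q 0 ^ 2 + q 2 ^ 2 := Real.sq_sqrt (by positivity)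
  have hx0 : 0 ≤ x := Real.sqrt_nonneg _
  have hu0 : 0 ≤ u := Real.sqrt_nonneg _
  set D := dist (cyl p) (cyl q) with hD
  set D' := dist (cyl p) (reflect (cyl q)) with hD'
  have hD0 : 0 ≤ D := dist_nonneg
  have hD0' : 0 ≤ D' := dist_nonneg
  have h1 : D ^ 2 = (x - u) ^ 2 + (p 1 - q 1) ^ 2 := complex_dist_sq _ _
  have h2 : D' ^ 2 = (x + u) ^ 2 + (p 1 - q 1) ^ 2 := by
    rw [hD', complex_dist_sq, reflect_re, reflect_im, sub_neg_eq_add]; rfl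
  have hαD : α = (D + D') / 2 := rfl
  -- With `x`, `u` the distances to the axis, `α² + β² = x² + u² + (p 1 - q 1)²` and `α β = x u`.
  -- The law of cosines for an orbit thus becomes the one for a circle of radius `α` and a point of
  -- modulus `β`.
  set β := (D' - D) / 2 with hβ
  have hα0 : 0 ≤ α := semiSum_nonneg _ _
  have hβ0 : 0 ≤ β := by
    have : D ≤ D' := by
      rw [← sq_le_sq₀ hD0 hD0', h1, h2]; nlinarith [mul_nonneg hx0 hu0]
    rw [hβ]; linarith
  have hβα : β ≤ α := by rw [hβ, hαD]; linarith
  have hsum : α ^ 2 + β ^ 2 = x ^ 2 + u ^ 2 + (p 1 - q 1) ^ 2 := by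
    rw [hβ, hαD]; linear_combination (h1 + h2) / 2
  have hprod : α * β = x * u := by
    rw [hβ, hαD]; linear_combination (h2 - h1) / 4
  set N1 := p 0 * q 0 + p 2 * q 2
  set N2 := p 2 * q 0 - p 0 * q 2
  have hN : N1 ^ 2 + N2 ^ 2 = (α * β) ^ 2 := by
    rw [hprod, mul_pow, hx2, hu2]; ring
  -- `N1` and `N2` are the coefficients of `cos t` and `sin t` in the inner product of the
  -- horizontal parts of `p` and `rotation t q`. If `α = 0` both vanish and `a = 0` serves.
  obtain ⟨a1, a2, ha1, ha2, ha⟩ : ∃ a1 a2 : ℝ, α * a1 = N1 ∧ α * a2 = N2 ∧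
      a1 ^ 2 + a2 ^ 2 = β ^ 2 := by
    rcases hα0.eq_or_lt with h0 | h0
    · have hb : β = 0 := le_antisymm (h0 ▸ hβα) hβ0
      rw [← h0, zero_mul, zero_pow two_ne_zero] at hN
      refine ⟨0, 0, ?_, ?_, by simp [hb]⟩ <;> nlinarith [sq_nonneg N1, sq_nonneg N2]
    · refine ⟨N1 / α, N2 / α, by field_simp, by field_simp, ?_⟩
      rw [div_pow, div_pow, ← add_div, hN]; field_simp
  refine ⟨⟨a1, a2⟩, ?_, fun t => ?_⟩
  · rw [Complex.norm_eq_sqrt_sq_add_sq]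
    simp only [ha, Real.sqrt_sq hβ0, hβα]
  · rw [← sq_eq_sq₀ dist_nonneg (norm_nonneg _), dist_sq_eq, Complex.sq_norm,
      Complex.normSq_apply]
    simp only [rotation_apply_zero, rotation_apply_one, rotation_apply_two, Complex.sub_re,
      Complex.sub_im, circleMap, Complex.exp_mul_I, zero_add, Complex.mul_re, Complex.mul_im,
      Complex.ofReal_re, Complex.ofReal_im, Complex.add_re, Complex.add_im, Complex.cos_ofReal_re,
      Complex.cos_ofReal_im, Complex.sin_ofReal_re, Complex.sin_ofReal_im, Complex.I_re,
      Complex.I_im]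
    linear_combination -hx2 - hu2 + 2 * Real.cos t * ha1 + 2 * Real.sin t * ha2
      - hsum - (α ^ 2 - q 0 ^ 2 - q 2 ^ 2) * Real.sin_sq_add_cos_sq t - ha

/-! ### Averaging over rotations -/

/-- The uniform probability distribution on the angles. -/
def angleMeasure : Measure ℝ :=
  (ENNReal.ofReal (2 * Real.pi))⁻¹ • volume.restrict (Set.Ioc 0 (2 * Real.pi))

instance : IsProbabilityMeasure angleMeasure := by
  constructor
  have h : ENNReal.ofReal (2 * Real.pi) ≠ 0 := by simp [Real.pi_pos]
  simp only [angleMeasure, Measure.smul_apply, Measure.restrict_apply_univ, Real.volume_Ioc,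
    sub_zero, smul_eq_mul]
  exact ENNReal.inv_mul_cancel h ENNReal.ofReal_ne_top

/-- The mean of the logarithmic kernel over rotations is the reduced kernel. -/
lemma lintegral_logRatio_rotation {R : ℝ} (hR : 0 < R) {p q : Space} (hp : ‖p‖ ≤ R / 2)
    (hq : ‖q‖ ≤ R / 2) :
    ∫⁻ t, logRatio R (dist p (rotation t q)) ∂angleMeasure =
      logRatio R (semiSum (cyl p) (cyl q)) := by
  obtain ⟨a, ha, hd⟩ := exists_dist_rotation_eq p q
  set α := semiSum (cyl p) (cyl q)
  have hle : ∀ t, ‖circleMap 0 α t - a‖ ≤ R := fun t => by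
    rw [← hd, dist_eq_norm]
    refine (norm_sub_le _ _).trans ?_
    rw [norm_rotation]; linarith
  simp_rw [hd]
  -- If the circle degenerates to a point, `a` is that point and both sides are infinite.
  rcases (semiSum_nonneg (cyl p) (cyl q)).eq_or_lt with h0 | h0
  · change 0 = α at h0
    rw [← h0] at ha ⊢
    have : a = 0 := by simpa using ha
    simp [this, logRatio_zero hR, circleMap]
  change 0 < α at h0
  have hπ : ENNReal.ofReal (2 * Real.pi) ≠ 0 := by simp [Real.pi_pos]
  have hne : ∀ᵐ t ∂(volume.restrict (Set.Ioc 0 (2 * Real.pi))), circleMap 0 α t ≠ a :=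
    ae_restrict_of_ae (measure_mono_null (fun t ht => by simpa using ht)
      (((Set.countable_singleton a).preimage_circleMap 0 h0.ne').measure_zero volume))
  have hcongr : ∀ᵐ t ∂(volume.restrict (Set.Ioc 0 (2 * Real.pi))),
      logRatio R ‖circleMap 0 α t - a‖ =
        ENNReal.ofReal (Real.log R - Real.log ‖circleMap 0 α t - a‖) := by
    filter_upwards [hne] with t ht
    exact logRatio_of_pos hR (norm_pos_iff.2 (sub_ne_zero.2 ht))
  have hint : IntervalIntegrable (fun t => Real.log ‖circleMap 0 α t - a‖) volume 0
      (2 * Real.pi) := circleIntegrable_log_norm_sub_const α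
  -- For `a` in the closed disc, boundary included, the average depends only on the radius.
  have hav := circleAverage_log_norm_sub_const_of_mem_closedBall (c := 0) (R := α) (a := a)
    (by simpa [abs_of_pos h0] using ha)
  rw [Real.circleAverage, smul_eq_mul] at hav
  have hval : ∫ t in (0 : ℝ)..(2 * Real.pi), Real.log ‖circleMap 0 α t - a‖ =
      2 * Real.pi * Real.log α := by
    rw [← hav]; field_simp
  have hint' : IntervalIntegrable (fun t => Real.log R - Real.log ‖circleMap 0 α t - a‖) volume 0
      (2 * Real.pi) := intervalIntegrable_const.sub hint
  rw [angleMeasure, lintegral_smul_measure, lintegral_congr_ae hcongr,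
    ← ofReal_integral_eq_lintegral_ofReal
      ((intervalIntegrable_iff_integrableOn_Ioc_of_le Real.two_pi_pos.le).1 hint'),
    ← intervalIntegral.integral_of_le Real.two_pi_pos.le,
    intervalIntegral.integral_sub intervalIntegrable_const hint, hval,
    intervalIntegral.integral_const, logRatio_of_pos hR h0]
  · have : (2 * Real.pi - 0) • Real.log R - 2 * Real.pi * Real.log α =
        2 * Real.pi * (Real.log R - Real.log α) := by simp; ring
    rw [this, ENNReal.ofReal_mul Real.two_pi_pos.le, smul_eq_mul, ← mul_assoc,
      ENNReal.inv_mul_cancel hπ ENNReal.ofReal_ne_top, one_mul]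
  · filter_upwards [hne] with t ht
    exact sub_nonneg.2 (Real.log_le_log (norm_pos_iff.2 (sub_ne_zero.2 ht)) (hle t))

/-- The rotationally symmetric measure on space with a given image in the half-plane. -/
def lift (lam : Measure ℂ) : Measure Space :=
  (lam.prod angleMeasure).map fun x => rotation x.2 (embed x.1)

lemma measurable_rotation_embed :
    Measurable fun x : ℂ × ℝ => rotation x.2 (embed x.1) :=
  (continuous_rotation.comp
    ((continuous_embed.comp continuous_fst).prodMk continuous_snd)).measurable

lemma measurable_rotation (t : ℝ) : Measurable (rotation t) :=
  (continuous_rotation.comp (Continuous.prodMk_left t)).measurable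

instance (lam : Measure ℂ) [IsProbabilityMeasure lam] : IsProbabilityMeasure (lift lam) :=
  Measure.isProbabilityMeasure_map measurable_rotation_embed.aemeasurable

lemma map_cyl_lift {lam : Measure ℂ} [IsProbabilityMeasure lam] (h : ∀ᵐ z ∂lam, 0 ≤ z.re) :
    (lift lam).map cyl = lam := by
  rw [lift, Measure.map_map continuous_cyl.measurable measurable_rotation_embed]
  have : cyl ∘ (fun x : ℂ × ℝ => rotation x.2 (embed x.1)) =ᵐ[lam.prod angleMeasure]
      Prod.fst := by
    filter_upwards [(Measure.quasiMeasurePreserving_fst (μ := lam) (ν := angleMeasure)).ae h]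
      with x hx
    simp [cyl_rotation, cyl_embed hx]
  rw [Measure.map_congr this]
  exact Measure.map_fst_prod.trans (by simp)

/-- The non-negative version of the reduced kernel on a set of diameter at most `R`. -/
def reducedRatioKernel (R : ℝ) (z w : ℂ) : ℝ≥0∞ := logRatio R (semiSum z w)

lemma continuous_reducedRatioKernel (R : ℝ) :
    Continuous fun x : ℂ × ℂ => reducedRatioKernel R x.1 x.2 :=
  (continuous_logRatio R).comp continuous_semiSum

lemma mutualEnergy_map {X X' Y Y' : Type*} [MeasurableSpace X] [MeasurableSpace X']
    [MeasurableSpace Y] [MeasurableSpace Y'] {k : X' → Y' → ℝ≥0∞}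
    (hk : Measurable fun x : X' × Y' => k x.1 x.2) {f : X → X'} (hf : Measurable f) {g : Y → Y'}
    (hg : Measurable g) (μ : Measure X) (ν : Measure Y) [SFinite ν] :
    mutualEnergy k (μ.map f) (ν.map g) = mutualEnergy (fun x y => k (f x) (g y)) μ ν := by
  unfold mutualEnergy
  have h : Measurable fun x => ∫⁻ y, k x y ∂(ν.map g) := hk.lintegral_prod_right'
  rw [lintegral_map h hf]
  refine lintegral_congr fun x => ?_
  have h' : Measurable fun y => k (f x) y := hk.comp measurable_prodMk_left
  rw [lintegral_map h' hg]

lemma lintegral_logRatioKernel_lift {R : ℝ} (hR : 0 < R) {p : Space} (hp : ‖p‖ ≤ R / 2)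
    {lam : Measure ℂ} [IsProbabilityMeasure lam] (hlam : ∀ᵐ z ∂lam, 0 ≤ z.re ∧ ‖z‖ ≤ R / 2) :
    ∫⁻ q, logRatioKernel R p q ∂(lift lam) = ∫⁻ z, reducedRatioKernel R (cyl p) z ∂lam := by
  have hm : Measurable fun q : Space => logRatioKernel R p q :=
    ((continuous_logRatio R).comp (continuous_const.dist continuous_id)).measurable
  have h3 : ∀ᵐ z ∂lam, ∫⁻ t, logRatioKernel R p (rotation t (embed z)) ∂angleMeasure =
      reducedRatioKernel R (cyl p) z := by
    filter_upwards [hlam] with z hz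
    have h := lintegral_logRatio_rotation hR hp (q := embed z) (by rw [norm_embed]; exact hz.2)
    rw [cyl_embed hz.1] at h
    exact h
  rw [lift, lintegral_map hm measurable_rotation_embed, ← lintegral_congr_ae h3]
  exact lintegral_prod _ (hm.comp measurable_rotation_embed).aemeasurable

/-- Only one of the two measures has to be rotationally symmetric: averaging over its angle already
replaces the kernel by the reduced one. -/
lemma mutualEnergy_lift {R : ℝ} (hR : 0 < R) {μ : Measure Space} {lam : Measure ℂ}
    [IsProbabilityMeasure lam] (hμ : ∀ᵐ p ∂μ, ‖p‖ ≤ R / 2)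
    (hlam : ∀ᵐ z ∂lam, 0 ≤ z.re ∧ ‖z‖ ≤ R / 2) :
    mutualEnergy (logRatioKernel R) μ (lift lam) =
      mutualEnergy (reducedRatioKernel R) (μ.map cyl) lam := by
  have h2 := mutualEnergy_map (continuous_reducedRatioKernel R).measurable
    continuous_cyl.measurable measurable_id μ lam
  rw [Measure.map_id] at h2
  rw [h2]
  exact lintegral_congr_ae (hμ.mono fun p hp => lintegral_logRatioKernel_lift hR hp hlam)

lemma mutualEnergy_map_rotation (R : ℝ) (t : ℝ) (ν : Measure Space) [SFinite ν] :
    mutualEnergy (logRatioKernel R) (ν.map (rotation t)) (ν.map (rotation t)) =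
      mutualEnergy (logRatioKernel R) ν ν := by
  rw [mutualEnergy_map (measurable_logRatioKernel R) (measurable_rotation t)
    (measurable_rotation t)]
  simp only [logRatioKernel, dist_rotation_rotation]
  rfl

/-- Averaging over rotations does not increase the energy. -/
lemma mutualEnergy_map_cyl_le {R : ℝ} (hR : 0 < R) {ν : Measure Space} [IsProbabilityMeasure ν]
    (hν : ∀ᵐ p ∂ν, ‖p‖ ≤ R / 2) :
    mutualEnergy (reducedRatioKernel R) (ν.map cyl) (ν.map cyl) ≤
      mutualEnergy (logRatioKernel R) ν ν := by
  have hprob : IsProbabilityMeasure (ν.map cyl) :=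
    Measure.isProbabilityMeasure_map continuous_cyl.measurable.aemeasurable
  have hc : Continuous fun x : Space × Space × ℝ =>
      logRatio R (dist x.1 (rotation x.2.2 x.2.1)) :=
    (continuous_logRatio R).comp
      (continuous_fst.dist (continuous_rotation.comp continuous_snd))
  have h1 : mutualEnergy (reducedRatioKernel R) (ν.map cyl) (ν.map cyl) =
      ∫⁻ p, ∫⁻ q, ∫⁻ t, logRatio R (dist p (rotation t q)) ∂angleMeasure ∂ν ∂ν := by
    rw [mutualEnergy_map (continuous_reducedRatioKernel R).measurable
      continuous_cyl.measurable continuous_cyl.measurable]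
    refine lintegral_congr_ae ?_
    filter_upwards [hν] with p hp
    refine lintegral_congr_ae ?_
    filter_upwards [hν] with q hq
    simp only [reducedRatioKernel]
    rw [lintegral_logRatio_rotation hR hp hq]
  have h2 : ∫⁻ p, ∫⁻ q, ∫⁻ t, logRatio R (dist p (rotation t q)) ∂angleMeasure ∂ν ∂ν =
      ∫⁻ t, mutualEnergy (logRatioKernel R) ν (ν.map (rotation t)) ∂angleMeasure := by
    have h3 : ∀ p, ∫⁻ q, ∫⁻ t, logRatio R (dist p (rotation t q)) ∂angleMeasure ∂ν =
        ∫⁻ t, ∫⁻ q, logRatio R (dist p (rotation t q)) ∂ν ∂angleMeasure := fun p =>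
      lintegral_lintegral_swap
        (hc.comp (Continuous.prodMk_right p)).measurable.aemeasurable
    simp_rw [h3]
    rw [lintegral_lintegral_swap]
    · refine lintegral_congr fun t => ?_
      have h := mutualEnergy_map (measurable_logRatioKernel R) measurable_id
        (measurable_rotation t) ν ν
      rw [Measure.map_id] at h
      rw [h]
      rfl
    · have hc' : Continuous fun x : (Space × ℝ) × Space =>
          logRatio R (dist x.1.1 (rotation x.1.2 x.2)) :=
        hc.comp (f := fun x : (Space × ℝ) × Space => (x.1.1, x.2, x.1.2)) (by fun_prop)
      exact (Measurable.lintegral_prod_right' hc'.measurable).aemeasurable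
  rw [h1, h2]
  calc ∫⁻ t, mutualEnergy (logRatioKernel R) ν (ν.map (rotation t)) ∂angleMeasure
      ≤ ∫⁻ _, mutualEnergy (logRatioKernel R) ν ν ∂angleMeasure := by
        refine lintegral_mono fun t => ?_
        have : IsProbabilityMeasure (ν.map (rotation t)) :=
          Measure.isProbabilityMeasure_map (measurable_rotation t).aemeasurable
        -- A measure and its rotated copy have equal energy, so positive definiteness bounds their
        -- mutual energy by that common value.
        have h := two_mul_mutualEnergy_le hR hν (ν := ν.map (rotation t)) (by
          rw [ae_map_iff (measurable_rotation t).aemeasurable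
            (measurableSet_le measurable_norm measurable_const)]
          simpa only [norm_rotation] using hν)
        rw [mutualEnergy_map_rotation, ← two_mul] at h
        exact (ENNReal.mul_le_mul_iff_right two_ne_zero ENNReal.ofNat_ne_top).1 h
    _ = mutualEnergy (logRatioKernel R) ν ν := by simp

/-! ### From extended-real energies to non-negative ones -/

/-- The parts of `g - C` satisfy `(g - C)⁺ + C = g + (C - g)⁺`. Integrating is harmless because the
negative part is at most `C`, so `∞ - ∞` never arises. -/
lemma extIntegral_eq_lintegral_sub {X : Type*} [MeasurableSpace X] {μ : Measure X}
    [IsProbabilityMeasure μ] {f : X → EReal} {g : X → ℝ≥0∞} (hg : Measurable g) {c : ℝ}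
    (hc : 0 ≤ c) (hfg : ∀ᵐ x ∂μ, f x = (g x : EReal) - (c : EReal)) :
    extIntegral f μ = ((∫⁻ x, g x ∂μ : ℝ≥0∞) : EReal) - (c : EReal) := by
  set C := ENNReal.ofReal c with hC
  have hcC : (c : EReal) = (C : EReal) := by rw [hC, EReal.coe_ennreal_ofReal, max_eq_left hc]
  have hCtop : C ≠ ⊤ := ENNReal.ofReal_ne_top
  have hpos : ∀ᵐ x ∂μ, (f x).toENNReal = g x - C := by
    filter_upwards [hfg] with x hx
    rw [hx, hcC, EReal.toENNReal_sub (EReal.coe_ennreal_nonneg _)]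
    simp
  have hneg : ∀ᵐ x ∂μ, (-f x).toENNReal = C - g x := by
    filter_upwards [hfg] with x hx
    have : -((g x : EReal) - (C : EReal)) = (C : EReal) - g x := by
      rw [EReal.neg_sub (by simp) (by simp [hCtop]), add_comm, sub_eq_add_neg]
    rw [hx, hcC, this, EReal.toENNReal_sub (EReal.coe_ennreal_nonneg _)]
    simp
  rw [extIntegral, lintegral_congr_ae hpos, lintegral_congr_ae hneg, hcC]
  have hsum : ∫⁻ x, (g x - C) ∂μ + C = ∫⁻ x, g x ∂μ + ∫⁻ x, (C - g x) ∂μ := by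
    rw [← lintegral_add_left hg]
    calc ∫⁻ x, (g x - C) ∂μ + C = ∫⁻ x, (g x - C) ∂μ + ∫⁻ _, C ∂μ := by simp
      _ = ∫⁻ x, (g x - C + C) ∂μ := (lintegral_add_right _ measurable_const).symm
      _ = ∫⁻ x, (g x + (C - g x)) ∂μ := by
        refine lintegral_congr fun x => ?_
        rw [tsub_add_eq_max, add_tsub_eq_max]
  have hN : ∫⁻ x, (C - g x) ∂μ ≠ ⊤ := by
    refine ne_top_of_le_ne_top hCtop ?_
    calc ∫⁻ x, (C - g x) ∂μ ≤ ∫⁻ _, C ∂μ := lintegral_mono fun x => tsub_le_self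
      _ = C := by simp
  clear_value C
  generalize (∫⁻ x, (g x - C) ∂μ) = P at *
  generalize (∫⁻ x, (C - g x) ∂μ) = N at *
  generalize (∫⁻ x, g x ∂μ) = G at *
  by_cases hG : G = ⊤
  · have hP : P = ⊤ := by
      by_contra hP
      rw [hG, top_add] at hsum
      exact ENNReal.add_ne_top.2 ⟨hP, hCtop⟩ hsum
    lift N to NNReal using hN
    lift C to NNReal using hCtop
    rw [hG, hP]
    rw [EReal.coe_nnreal_eq_coe_real, EReal.coe_nnreal_eq_coe_real, EReal.coe_ennreal_top,
      EReal.top_sub_coe, EReal.top_sub_coe]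
  · have hP : P ≠ ⊤ := by
      rintro rfl
      rw [top_add] at hsum
      exact ENNReal.add_ne_top.2 ⟨hG, hN⟩ hsum.symm
    lift N to NNReal using hN
    lift C to NNReal using hCtop
    lift P to NNReal using hP
    lift G to NNReal using hG
    have h : (P : ℝ) + C = G + N := by exact_mod_cast hsum
    have h' : (P : ℝ) - N = G - C := by linarith
    simp only [EReal.coe_nnreal_eq_coe_real]
    exact_mod_cast h'

lemma energy_eq_mutualEnergy_sub {X : Type*} [MeasurableSpace X] {μ : Measure X}
    [IsProbabilityMeasure μ] {k : X → X → EReal} {k' : X → X → ℝ≥0∞}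
    (hk' : Measurable fun x : X × X => k' x.1 x.2) {c : ℝ} (hc : 0 ≤ c) {S : Set X}
    (hS : ∀ᵐ x ∂μ, x ∈ S) (hkk : ∀ x ∈ S, ∀ y ∈ S, k x y = (k' x y : EReal) - (c : EReal)) :
    energy k μ = ((mutualEnergy k' μ μ : ℝ≥0∞) : EReal) - (c : EReal) := by
  rw [energy, extIntegral_eq_lintegral_sub hk' hc, mutualEnergy, lintegral_prod _ hk'.aemeasurable]
  filter_upwards [(Measure.quasiMeasurePreserving_fst (μ := μ) (ν := μ)).ae hS,
    (Measure.quasiMeasurePreserving_snd (μ := μ) (ν := μ)).ae hS] with x h1 h2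
  exact hkk _ h1 _ h2

/-- For `r ≤ R` the logarithm of `R / r` is non-negative, so taking its positive part loses nothing.
-/
lemma log_one_div_eq {R r : ℝ} (hR : 0 < R) (hr : 0 ≤ r) (hrR : r ≤ R) :
    ENNReal.log (1 / ENNReal.ofReal r) = (logRatio R r : EReal) - (Real.log R : EReal) := by
  rcases hr.eq_or_lt with rfl | hr
  · rw [logRatio_zero hR]
    simp
  · have h := Real.log_le_log hr hrR
    rw [logRatio_of_pos hR hr, ← ENNReal.ofReal_one, ← ENNReal.ofReal_div_of_pos hr,
      ENNReal.log_ofReal_of_pos (by positivity), one_div, Real.log_inv, EReal.coe_ennreal_ofReal,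
      max_eq_left (by linarith), ← EReal.coe_sub]
    congr 1; ring

lemma logKernel_eq {R : ℝ} (hR : 0 < R) {p q : Space} (hp : ‖p‖ ≤ R / 2) (hq : ‖q‖ ≤ R / 2) :
    logKernel p q = (logRatioKernel R p q : EReal) - (Real.log R : EReal) := by
  rw [logKernel, edist_dist, logRatioKernel]
  refine log_one_div_eq hR dist_nonneg ?_
  rw [dist_eq_norm]
  exact (norm_sub_le _ _).trans (by linarith)

lemma reducedKernel_eq {R : ℝ} (hR : 0 < R) {z w : ℂ} (hz : ‖z‖ ≤ R / 2) (hw : ‖w‖ ≤ R / 2) :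
    reducedKernel z w = (reducedRatioKernel R z w : EReal) - (Real.log R : EReal) := by
  rw [reducedKernel, reducedRatioKernel, ← log_one_div_eq hR (semiSum_nonneg z w)
    (semiSum_le hz hw),
    edist_dist, edist_dist, ← ENNReal.ofReal_add dist_nonneg dist_nonneg, semiSum,
    ENNReal.ofReal_div_of_pos two_pos, one_div, ENNReal.inv_div (by simp) (by simp)]
  simp

/-! ### Existence of a minimizer -/

section Minimizer

variable {X : Type*} [TopologicalSpace X] [MeasurableSpace X]

/-- The truncations `min k n` are bounded and continuous, so their integrals are weakly continuous;
a supremum of continuous functions is lower semicontinuous. -/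
lemma lowerSemicontinuous_lintegral_probabilityMeasure [OpensMeasurableSpace X] {k : X → ℝ≥0∞}
    (hk : Continuous k) :
    LowerSemicontinuous fun P : ProbabilityMeasure X => ∫⁻ x, k x ∂(P : Measure X) := by
  have h : (fun P : ProbabilityMeasure X => ∫⁻ x, k x ∂(P : Measure X)) =
      fun P : ProbabilityMeasure X => ⨆ n : ℕ, ∫⁻ x, min (k x) n ∂(P : Measure X) := by
    funext P
    rw [← lintegral_iSup (fun n => (hk.min continuous_const).measurable)]
    · refine lintegral_congr fun x => ?_
      rw [← inf_iSup_eq, ENNReal.iSup_natCast, inf_top_eq]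
    · intro m n hmn x
      exact min_le_min_left _ (by exact_mod_cast hmn)
  rw [h]
  refine lowerSemicontinuous_iSup fun n => Continuous.lowerSemicontinuous ?_
  have hlt : ∀ x, min (k x) n ≠ ⊤ := fun x =>
    ne_top_of_le_ne_top (ENNReal.natCast_ne_top n) (min_le_right _ _)
  have hc : Continuous fun x => (min (k x) n).toNNReal :=
    continuous_iff_continuousAt.2 fun x =>
      (ENNReal.tendsto_toNNReal (hlt x)).comp (hk.min continuous_const).continuousAt
  let f : BoundedContinuousFunction X NNReal := BoundedContinuousFunction.mkOfBound ⟨_, hc⟩ n (by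
    intro x y
    have hb : ∀ x, (min (k x) n).toNNReal ≤ (n : NNReal) := fun x => by
      rw [← ENNReal.coe_le_coe, ENNReal.coe_toNNReal (hlt x)]
      exact_mod_cast min_le_right _ _
    have h1 : (((min (k x) n).toNNReal : NNReal) : ℝ) ≤ n := by exact_mod_cast hb x
    have h2 : (((min (k y) n).toNNReal : NNReal) : ℝ) ≤ n := by exact_mod_cast hb y
    have h3 := (min (k x) n).toNNReal.coe_nonneg
    have h4 := (min (k y) n).toNNReal.coe_nonneg
    rw [ContinuousMap.coe_mk, NNReal.dist_eq, abs_le]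
    constructor <;> linarith)
  have hf : ∀ x, min (k x) n = (f x : ℝ≥0∞) := fun x => (ENNReal.coe_toNNReal (hlt x)).symm
  simp_rw [hf]
  exact continuous_iff_continuousAt.2 fun P =>
    ProbabilityMeasure.tendsto_iff_forall_lintegral_tendsto.1 Filter.tendsto_id f

end Minimizer

/-- Probability measures on the compact subtype `A` form a weakly compact space on which the energy
is lower semicontinuous. Push-forward and `comap` along the inclusion transfer the minimum to
measures on `ℂ`. -/
lemma exists_minimal_mutualEnergy {A : Set ℂ} (hne : A.Nonempty) (hA : IsCompact A)
    {k : ℂ → ℂ → ℝ≥0∞} (hk : Continuous fun x : ℂ × ℂ => k x.1 x.2) :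
    ∃ μ ∈ probMeasuresOn A, ∀ ν ∈ probMeasuresOn A, mutualEnergy k μ μ ≤ mutualEnergy k ν ν := by
  have : CompactSpace A := isCompact_iff_compactSpace.1 hA
  obtain ⟨z, hz⟩ := hne
  let P₀ : ProbabilityMeasure A := ⟨Measure.dirac ⟨z, hz⟩, inferInstance⟩
  have hmA := hA.isClosed.measurableSet
  have hkA : Continuous fun x : A × A => k x.1 x.2 :=
    hk.comp (f := fun x : A × A => ((x.1 : ℂ), (x.2 : ℂ))) (by fun_prop)
  have hl : LowerSemicontinuous fun P : ProbabilityMeasure A =>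
      ∫⁻ x, k x.1 x.2 ∂((P.prod P : ProbabilityMeasure (A × A)) : Measure (A × A)) :=
    (lowerSemicontinuous_lintegral_probabilityMeasure hkA).comp
      (ProbabilityMeasure.continuous_prod.comp (continuous_id.prodMk continuous_id))
  obtain ⟨P, -, hP⟩ := (hl.lowerSemicontinuousOn Set.univ).exists_isMinOn
    ⟨P₀, Set.mem_univ _⟩ isCompact_univ
  have henergy : ∀ Q : ProbabilityMeasure A,
      mutualEnergy k ((Q : Measure A).map (↑)) ((Q : Measure A).map (↑)) =
      ∫⁻ x, k x.1 x.2 ∂((Q.prod Q : ProbabilityMeasure (A × A)) : Measure (A × A)) := by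
    intro Q
    rw [mutualEnergy_map hk.measurable measurable_subtype_coe measurable_subtype_coe,
      ProbabilityMeasure.toMeasure_prod, lintegral_prod _ hkA.measurable.aemeasurable]
    rfl
  refine ⟨(P : Measure A).map (↑), ⟨Measure.isProbabilityMeasure_map (by fun_prop), ?_⟩, ?_⟩
  · rw [Measure.map_apply measurable_subtype_coe hmA.compl]
    simp
  · rintro ν ⟨hν, hνA⟩
    have hmap : (ν.comap ((↑) : A → ℂ)).map (↑) = ν := by
      rw [map_comap_subtype_coe hmA, Measure.restrict_eq_self_of_ae_mem]
      exact hνA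
    have hprob : IsProbabilityMeasure (ν.comap ((↑) : A → ℂ)) := by
      constructor
      rw [← Set.preimage_univ (f := ((↑) : A → ℂ)),
        ← Measure.map_apply measurable_subtype_coe .univ, hmap, measure_univ]
    let Q : ProbabilityMeasure A := ⟨ν.comap (↑), hprob⟩
    have hQ : (Q : Measure A).map (↑) = ν := hmap
    have h : ∫⁻ x, k x.1 x.2 ∂((P.prod P : ProbabilityMeasure (A × A)) : Measure (A × A)) ≤
        ∫⁻ x, k x.1 x.2 ∂((Q.prod Q : ProbabilityMeasure (A × A)) : Measure (A × A)) :=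
      hP (Set.mem_univ Q)
    rwa [← henergy, ← henergy, hQ] at h

/-! ### The variational inequality -/

section Variational

variable {X : Type*} [MeasurableSpace X] {k : X → X → ℝ≥0∞}

lemma mutualEnergy_add_left (μ₁ μ₂ ν : Measure X) :
    mutualEnergy k (μ₁ + μ₂) ν = mutualEnergy k μ₁ ν + mutualEnergy k μ₂ ν :=
  lintegral_add_measure _ _ _

lemma mutualEnergy_smul_left (c : ℝ≥0∞) (μ ν : Measure X) :
    mutualEnergy k (c • μ) ν = c * mutualEnergy k μ ν :=
  lintegral_smul_measure _ _

lemma mutualEnergy_add_right (hk : Measurable fun x : X × X => k x.1 x.2)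
    (μ ν₁ ν₂ : Measure X) [SFinite ν₁] :
    mutualEnergy k μ (ν₁ + ν₂) = mutualEnergy k μ ν₁ + mutualEnergy k μ ν₂ := by
  have h : Measurable fun x => ∫⁻ y, k x y ∂ν₁ := hk.lintegral_prod_right'
  simp only [mutualEnergy, lintegral_add_measure]
  exact lintegral_add_left h _

lemma mutualEnergy_smul_right {c : ℝ≥0∞} (hc : c ≠ ⊤) (μ ν : Measure X) :
    mutualEnergy k μ (c • ν) = c * mutualEnergy k μ ν := by
  simp only [mutualEnergy, lintegral_smul_measure, smul_eq_mul]
  exact lintegral_const_mul' _ _ hc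

lemma mutualEnergy_mono {μ μ' ν ν' : Measure X} (hμ : μ ≤ μ') (hν : ν ≤ ν') :
    mutualEnergy k μ ν ≤ mutualEnergy k μ' ν' :=
  lintegral_mono' hμ fun _ => lintegral_mono' hν le_rfl

/-- A minimizer of the energy has no larger energy than its mutual energy with any competitor. -/
lemma mutualEnergy_self_le_of_minimal (hk : Measurable fun x : X × X => k x.1 x.2)
    (hsymm : ∀ x y, k x y = k y x) {S : Set X} {μ σ : Measure X} (hμ : μ ∈ probMeasuresOn S)
    (hmin : ∀ ν ∈ probMeasuresOn S, mutualEnergy k μ μ ≤ mutualEnergy k ν ν)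
    (hσ : σ ∈ probMeasuresOn S) (hfin : mutualEnergy k σ σ ≠ ⊤) :
    mutualEnergy k μ μ ≤ mutualEnergy k μ σ := by
  obtain ⟨hμ1, hμ2⟩ := hμ
  obtain ⟨hσ1, hσ2⟩ := hσ
  have hF : mutualEnergy k μ μ ≠ ⊤ := ne_top_of_le_ne_top hfin (hmin σ ⟨hσ1, hσ2⟩)
  by_contra! hlt
  have hM : mutualEnergy k μ σ ≠ ⊤ := hlt.ne_top
  -- Compare `μ` with the mixture `(1 - ε) μ + ε σ`.
  have hcomb : ∀ ε : NNReal, ε ≤ 1 → mutualEnergy k μ μ ≤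
      ((1 - ε : NNReal) : ℝ≥0∞) * (((1 - ε : NNReal) : ℝ≥0∞) * mutualEnergy k μ μ) +
      ((1 - ε : NNReal) : ℝ≥0∞) * (ε * mutualEnergy k μ σ) +
      (ε * (((1 - ε : NNReal) : ℝ≥0∞) * mutualEnergy k μ σ) +
        ε * (ε * mutualEnergy k σ σ)) := by
    intro ε hε
    refine (hmin (((1 - ε : NNReal) : ℝ≥0∞) • μ + (ε : ℝ≥0∞) • σ) ⟨⟨?_⟩, ?_⟩).trans_eq ?_
    · simp only [Measure.add_apply, Measure.smul_apply, measure_univ, smul_eq_mul, mul_one]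
      rw [← ENNReal.coe_add, tsub_add_cancel_of_le hε, ENNReal.coe_one]
    · simp [hμ2, hσ2]
    · have : SFinite (((1 - ε : NNReal) : ℝ≥0∞) • μ) := inferInstance
      rw [mutualEnergy_add_left, mutualEnergy_add_right hk, mutualEnergy_add_right hk,
        mutualEnergy_smul_left, mutualEnergy_smul_left, mutualEnergy_smul_left,
        mutualEnergy_smul_left, mutualEnergy_smul_right ENNReal.coe_ne_top,
        mutualEnergy_smul_right ENNReal.coe_ne_top, mutualEnergy_smul_right ENNReal.coe_ne_top,
        mutualEnergy_smul_right ENNReal.coe_ne_top, mutualEnergy_comm hk hsymm σ μ]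
  generalize mutualEnergy k μ μ = F at *
  generalize mutualEnergy k μ σ = M at *
  generalize mutualEnergy k σ σ = s at *
  lift F to NNReal using hF
  lift M to NNReal using hM
  lift s to NNReal using hfin
  have hlt' : (M : ℝ) < F := by exact_mod_cast hlt
  set d : ℝ := F - M with hd
  have hd0 : 0 < d := by rw [hd]; linarith
  set Z : ℝ := F - 2 * M + s with hZ
  -- The energy of the mixture is `F - 2 e d + e² Z`. This choice gives `e Z ≤ d < 2 d`, so the
  -- energy would drop below `F`.
  set e : ℝ := min 1 (d / (|Z| + 1)) with he
  have hZ0 : 0 < |Z| + 1 := by positivity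
  have he0 : 0 < e := lt_min one_pos (by positivity)
  have he1 : e ≤ 1 := min_le_left _ _
  have he2 : e * (|Z| + 1) ≤ d := (le_div_iff₀ hZ0).1 (min_le_right _ _)
  have hh' : (F : ℝ) ≤ (1 - e) * ((1 - e) * F) + (1 - e) * (e * M) +
      (e * ((1 - e) * M) + e * (e * s)) := by
    clear_value e
    lift e to NNReal using he0.le
    have h1 : e ≤ 1 := by exact_mod_cast he1
    have hh := hcomb e h1
    have h2 : ((1 - e : NNReal) : ℝ) = 1 - e := by rw [NNReal.coe_sub h1]; rfl
    rw [← h2]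
    exact_mod_cast hh
  have h3 : e * Z ≤ e * |Z| := mul_le_mul_of_nonneg_left (le_abs_self Z) he0.le
  have h4 : e * (2 * d - e * Z) ≤ 0 := by rw [hd, hZ]; linarith
  have h5 : 0 < 2 * d - e * Z := by nlinarith
  exact absurd (mul_pos he0 h5) (not_lt.2 h4)

end Variational

/-! ### Equilibrium measures from non-negative energies -/

lemma isEquilibriumMeasure_of_mutualEnergy {X : Type*} [MeasurableSpace X] {k : X → X → EReal}
    {k' : X → X → ℝ≥0∞} (hk' : Measurable fun x : X × X => k' x.1 x.2) {c : ℝ} (hc : 0 ≤ c)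
    {S : Set X} (hkk : ∀ x ∈ S, ∀ y ∈ S, k x y = (k' x y : EReal) - (c : EReal))
    {μ : Measure X} (hμ : μ ∈ probMeasuresOn S) (hfin : mutualEnergy k' μ μ ≠ ⊤)
    (hmin : ∀ ν ∈ probMeasuresOn S, mutualEnergy k' μ μ ≤ mutualEnergy k' ν ν)
    (huniq : ∀ ν ∈ probMeasuresOn S, mutualEnergy k' ν ν ≤ mutualEnergy k' μ μ → ν = μ) :
    IsEquilibriumMeasure k S μ := by
  have hE : ∀ ν ∈ probMeasuresOn S,
      energy k ν = ((mutualEnergy k' ν ν : ℝ≥0∞) : EReal) - (c : EReal) := by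
    rintro ν ⟨hν1, hν2⟩
    exact energy_eq_mutualEnergy_sub hk' hc hν2 hkk
  refine ⟨hμ, ?_, fun ν hν => ?_, fun ν hν h => huniq ν hν ?_⟩
  · rw [hE μ hμ]
    lift mutualEnergy k' μ μ to NNReal using hfin with F
    rw [EReal.coe_nnreal_eq_coe_real, ← EReal.coe_sub]
    exact EReal.coe_lt_top _
  · rw [hE μ hμ, hE ν hν]
    exact EReal.sub_le_sub (EReal.coe_ennreal_le_coe_ennreal_iff.2 (hmin ν hν)) le_rfl
  · rw [hE μ hμ, hE ν hν] at h
    have h' := congrArg (fun x : EReal => x + c) h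
    simp only [EReal.sub_add_cancel] at h'
    exact (EReal.coe_ennreal_injective h').le

lemma isEquilibriumMeasure_reducedKernel {R : ℝ} (hR : 1 ≤ R) {A : Set ℂ}
    (hA : ∀ z ∈ A, ‖z‖ ≤ R / 2) {lam : Measure ℂ} (hlam : lam ∈ probMeasuresOn A)
    (hfin : mutualEnergy (reducedRatioKernel R) lam lam ≠ ⊤)
    (hmin : ∀ ν ∈ probMeasuresOn A, mutualEnergy (reducedRatioKernel R) lam lam ≤
      mutualEnergy (reducedRatioKernel R) ν ν)
    (huniq : ∀ ν ∈ probMeasuresOn A, mutualEnergy (reducedRatioKernel R) ν ν ≤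
      mutualEnergy (reducedRatioKernel R) lam lam → ν = lam) :
    IsEquilibriumMeasure reducedKernel A lam :=
  isEquilibriumMeasure_of_mutualEnergy (continuous_reducedRatioKernel R).measurable
    (Real.log_nonneg hR)
    (fun z hz w hw => reducedKernel_eq (by linarith) (hA z hz) (hA w hw)) hlam hfin hmin huniq

lemma isEquilibriumMeasure_logKernel {R : ℝ} (hR : 1 ≤ R) {S : Set Space}
    (hS : ∀ p ∈ S, ‖p‖ ≤ R / 2) {μ : Measure Space} (hμ : μ ∈ probMeasuresOn S)
    (hfin : mutualEnergy (logRatioKernel R) μ μ ≠ ⊤)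
    (hmin : ∀ ν ∈ probMeasuresOn S, mutualEnergy (logRatioKernel R) μ μ ≤
      mutualEnergy (logRatioKernel R) ν ν)
    (huniq : ∀ ν ∈ probMeasuresOn S, mutualEnergy (logRatioKernel R) ν ν ≤
      mutualEnergy (logRatioKernel R) μ μ → ν = μ) :
    IsEquilibriumMeasure logKernel S μ :=
  isEquilibriumMeasure_of_mutualEnergy (measurable_logRatioKernel R) (Real.log_nonneg hR)
    (fun p hp q hq => logKernel_eq (by linarith) (hS p hp) (hS q hq)) hμ hfin hmin huniq

/-! ### Location of the support -/

section Support

lemma reducedRatioKernel_comm (R : ℝ) (z w : ℂ) :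
    reducedRatioKernel R z w = reducedRatioKernel R w z := by
  rw [reducedRatioKernel, reducedRatioKernel, semiSum_comm]

/-- The real parts of `z - w` and `z - reflect w` add up to `2 * z.re`. Consequently the reduced
kernel is bounded in `w` once `z` is off the axis, and point masses there have finite energy. -/
lemma re_le_semiSum (z w : ℂ) : z.re ≤ semiSum z w := by
  have h1 := Complex.re_le_norm (z - w)
  have h2 := Complex.re_le_norm (z - reflect w)
  rw [semiSum, dist_eq_norm, dist_eq_norm]
  rw [Complex.sub_re] at h1 h2
  rw [reflect_re] at h2
  linarith

lemma reducedRatioKernel_ne_top {R : ℝ} (hR : 0 < R) {z : ℂ} (hz : 0 < z.re) (w : ℂ) :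
    reducedRatioKernel R z w ≠ ⊤ := by
  rw [reducedRatioKernel, logRatio_of_pos hR (hz.trans_le (re_le_semiSum z w))]
  exact ENNReal.ofReal_ne_top

lemma lintegral_reducedRatioKernel_ne_top {R : ℝ} (hR : 0 < R) {z : ℂ} (hz : 0 < z.re)
    (lam : Measure ℂ) [IsFiniteMeasure lam] : ∫⁻ w, reducedRatioKernel R z w ∂lam ≠ ⊤ := by
  have h : ∫⁻ w, reducedRatioKernel R z w ∂lam ≤ ∫⁻ _, logRatio R z.re ∂lam :=
    lintegral_mono fun w => logRatio_anti R (re_le_semiSum z w)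
  refine ne_top_of_le_ne_top ?_ h
  rw [lintegral_const, logRatio_of_pos hR hz]
  exact ENNReal.mul_ne_top ENNReal.ofReal_ne_top (measure_ne_top _ _)

/-- Moving a point to the right increases the sum of its distances to a point and its
reflection. -/
lemma semiSum_mono {z z' : ℂ} (hz : 0 ≤ z.re) (hre : z.re ≤ z'.re) (him : z'.im = z.im) (w : ℂ) :
    semiSum z w ≤ semiSum z' w := by
  rcases (hz.trans hre).eq_or_lt with h0 | h0
  · have : z = z' := Complex.ext (by linarith) him.symm
    rw [this]
  -- The weight that writes `z` as a convex combination of `z'` and `reflect z'`. The sum of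
  -- distances is convex and takes the same value at both endpoints.
  set s : ℝ := (z'.re + z.re) / (2 * z'.re) with hs
  have hs0 : 0 ≤ s := by positivity
  have hs1 : s ≤ 1 := by rw [hs, div_le_one (by positivity)]; linarith
  have hcomb : z = s * z' + ((1 - s : ℝ) : ℂ) * reflect z' := by
    apply Complex.ext
    · simp only [Complex.add_re, Complex.re_ofReal_mul, reflect_re]
      rw [hs]; field_simp; ring
    · simp only [Complex.add_im, Complex.im_ofReal_mul, reflect_im, him]
      ring
  have htri : ∀ v : ℂ, dist z v ≤ s * dist z' v + (1 - s) * dist (reflect z') v := by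
    intro v
    have h : z - v = s * (z' - v) + ((1 - s : ℝ) : ℂ) * (reflect z' - v) := by
      conv_lhs => rw [hcomb]
      push_cast; ring
    rw [dist_eq_norm, dist_eq_norm, dist_eq_norm, h]
    refine (norm_add_le _ _).trans ?_
    rw [norm_mul, norm_mul, Complex.norm_real, Complex.norm_real, Real.norm_of_nonneg hs0,
      Real.norm_of_nonneg (by linarith : (0 : ℝ) ≤ 1 - s)]
  have hr1 : dist (reflect z') w = dist z' (reflect w) := by
    rw [← sq_eq_sq₀ dist_nonneg dist_nonneg, complex_dist_sq, complex_dist_sq]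
    simp only [reflect_re, reflect_im]; ring
  have hr2 : dist (reflect z') (reflect w) = dist z' w := by
    rw [← sq_eq_sq₀ dist_nonneg dist_nonneg, complex_dist_sq, complex_dist_sq]
    simp only [reflect_re, reflect_im]; ring
  have h1 := htri w
  have h2 := htri (reflect w)
  rw [hr1] at h1
  rw [hr2] at h2
  rw [semiSum, semiSum]
  linarith

lemma semiSum_eq_of_im_eq {z z' : ℂ} (hz : 0 ≤ z.re) (hre : z.re ≤ z'.re) (him : z'.im = z.im) :
    semiSum z' z = z'.re := by
  have h1 : dist z' z = z'.re - z.re := by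
    rw [← sq_eq_sq₀ dist_nonneg (by linarith), complex_dist_sq, him]; ring
  have h2 : dist z' (reflect z) = z'.re + z.re := by
    rw [← sq_eq_sq₀ dist_nonneg (by linarith), complex_dist_sq, reflect_re, reflect_im, him]; ring
  rw [semiSum, h1, h2]; ring

lemma exists_mem_rightMost {A : Set ℂ} (hA : IsCompact A) {z : ℂ} (hz : z ∈ A) :
    ∃ z' ∈ rightMost A, z' ∈ A ∧ z'.im = z.im ∧ z.re ≤ z'.re := by
  have hc : Continuous fun x : ℝ => (⟨x, z.im⟩ : ℂ) := by
    have : (fun x : ℝ => (⟨x, z.im⟩ : ℂ)) = fun x : ℝ => (x : ℂ) + z.im * Complex.I := by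
      funext x; apply Complex.ext <;> simp
    rw [this]; fun_prop
  have hcomp : IsCompact {x : ℝ | (⟨x, z.im⟩ : ℂ) ∈ A} := by
    refine (hA.image Complex.continuous_re).of_isClosed_subset (hA.isClosed.preimage hc) ?_
    intro x hx
    exact ⟨_, hx, rfl⟩
  obtain ⟨x, hx⟩ := hcomp.exists_isGreatest ⟨z.re, hz⟩
  exact ⟨⟨x, z.im⟩, hx, hx.1, rfl, hx.2 hz⟩

/-- Fatou's lemma: the potential is lower semicontinuous. -/
lemma eventually_lt_lintegral {k : ℂ → ℂ → ℝ≥0∞} (hk : Continuous fun x : ℂ × ℂ => k x.1 x.2)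
    (lam : Measure ℂ) {z₀ : ℂ} {c : ℝ≥0∞} (hc : c < ∫⁻ w, k z₀ w ∂lam) :
    ∀ᶠ z in 𝓝 z₀, c < ∫⁻ w, k z w ∂lam := by
  have h1 : ∫⁻ w, k z₀ w ∂lam ≤ Filter.liminf (fun z => ∫⁻ w, k z w ∂lam) (𝓝 z₀) := by
    calc ∫⁻ w, k z₀ w ∂lam = ∫⁻ w, Filter.liminf (fun z => k z w) (𝓝 z₀) ∂lam := by
          refine lintegral_congr fun w => ?_
          have : Continuous fun z => k z w := hk.comp (Continuous.prodMk_left w)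
          exact (this.tendsto z₀).liminf_eq.symm
      _ ≤ _ := lintegral_liminf_le fun z =>
          (hk.comp (Continuous.prodMk_right z)).measurable
  exact Filter.eventually_lt_of_lt_liminf (hc.trans_le h1)

/-- Moving a point of the support of a measure to the right strictly decreases its potential. -/
lemma lintegral_reducedRatioKernel_lt {R : ℝ} {A : Set ℂ}
    (hAR : ∀ z ∈ A, ‖z‖ ≤ R / 2) {lam : Measure ℂ} [IsFiniteMeasure lam]
    (hlam : ∀ᵐ z ∂lam, z ∈ A) {z z' : ℂ} (hz : z ∈ lam.support) (hz'A : z' ∈ A)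
    (hz0 : 0 ≤ z.re) (hre : z.re < z'.re) (him : z'.im = z.im) :
    ∫⁻ w, reducedRatioKernel R z' w ∂lam < ∫⁻ w, reducedRatioKernel R z w ∂lam := by
  have hR : 0 < R := by
    have := Complex.re_le_norm z'
    have := hAR z' hz'A
    linarith
  -- The comparison of kernels is weak in general but strict at `w = z`, hence on the open set `W`,
  -- which is charged because `z` lies in the support.
  set W : Set ℂ := {w | semiSum z w < semiSum z' w} with hW
  have hWo : IsOpen W := isOpen_lt (continuous_semiSum.comp (Continuous.prodMk_right z))
    (continuous_semiSum.comp (Continuous.prodMk_right z'))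
  have hzW : z ∈ W := by
    change semiSum z z < semiSum z' z
    rw [semiSum_eq_of_im_eq hz0 le_rfl rfl, semiSum_eq_of_im_eq hz0 hre.le him]
    exact hre
  have hpos := (Measure.mem_support_iff_forall z).1 hz W (hWo.mem_nhds hzW)
  refine lintegral_strict_mono_of_ae_le_of_ae_lt_on
    ((continuous_reducedRatioKernel R).comp (Continuous.prodMk_right z)).measurable.aemeasurable
    (lintegral_reducedRatioKernel_ne_top hR (hz0.trans_lt hre) lam)
    (.of_forall fun w => logRatio_anti R (semiSum_mono hz0 hre.le him w)) hpos.ne' ?_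
  filter_upwards [hlam] with w hwA hwW
  exact logRatio_lt (semiSum_nonneg z w) hwW (semiSum_le (hAR z' hz'A) (hAR w hwA))

/-- If a support point `z` had a point `z'` of `A` to its right, the potential would exceed its
value at `z'` throughout a neighbourhood `V` of `z`. Concentrating the mass of `V` at `z'` gives a
competitor whose mutual energy with `lam` is below the energy of `lam`. -/
lemma support_subset_rightMost {R : ℝ} {A : Set ℂ} (hA : IsCompact A)
    (hAH : A ⊆ rightHalfPlane) (hAR : ∀ z ∈ A, ‖z‖ ≤ R / 2) {lam : Measure ℂ}
    (hlam : lam ∈ probMeasuresOn A)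
    (hfin : mutualEnergy (reducedRatioKernel R) lam lam ≠ ⊤)
    (hmin : ∀ ν ∈ probMeasuresOn A, mutualEnergy (reducedRatioKernel R) lam lam ≤
      mutualEnergy (reducedRatioKernel R) ν ν) : lam.support ⊆ rightMost A := by
  have hlam' := hlam
  obtain ⟨hprob, hlamA⟩ := hlam
  have hm := (continuous_reducedRatioKernel R).measurable
  have hsymm := reducedRatioKernel_comm R
  intro z hz
  have hzA : z ∈ A := Measure.support_subset_of_isClosed hA.isClosed hlamA hz
  have hz0 : 0 ≤ z.re := hAH hzA
  obtain ⟨z', hz', hz'A, him, hle⟩ := exists_mem_rightMost hA hzA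
  rcases hle.eq_or_lt with heq | hlt
  · have : z = z' := Complex.ext heq him.symm
    rwa [this]
  exfalso
  have hz'0 : 0 < z'.re := hz0.trans_lt hlt
  have hR : 0 < R := by
    have := Complex.re_le_norm z'
    have := hAR z' hz'A
    linarith
  set U : ℂ → ℝ≥0∞ := fun z => ∫⁻ w, reducedRatioKernel R z w ∂lam with hU
  have hUm : Measurable U := hm.lintegral_prod_right'
  have hUz' : U z' ≠ ⊤ := lintegral_reducedRatioKernel_ne_top hR hz'0 lam
  obtain ⟨V, hV, hVo, hzV⟩ := eventually_nhds_iff.1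
    (eventually_lt_lintegral (continuous_reducedRatioKernel R) lam
      (lintegral_reducedRatioKernel_lt hAR hlamA hz hz'A hz0 hlt him))
  have hVpos := (Measure.mem_support_iff_forall z).1 hz V (hVo.mem_nhds hzV)
  set σ : Measure ℂ := lam.restrict Vᶜ + lam V • Measure.dirac z' with hσ
  have hσprob : σ ∈ probMeasuresOn A := by
    refine ⟨⟨?_⟩, ?_⟩
    · simp only [hσ, Measure.add_apply, Measure.smul_apply, measure_univ, smul_eq_mul, mul_one,
        Measure.restrict_apply_univ]
      rw [add_comm, measure_add_measure_compl hVo.measurableSet, measure_univ]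
    · have h1 : lam.restrict Vᶜ Aᶜ = 0 :=
        nonpos_iff_eq_zero.1 ((Measure.restrict_apply_le _ _).trans_eq hlamA)
      simp [hσ, h1, Measure.dirac_apply' _ hA.isClosed.measurableSet.compl, hz'A]
  have hdirac : ∀ ν : Measure ℂ, mutualEnergy (reducedRatioKernel R) (Measure.dirac z') ν =
      ∫⁻ w, reducedRatioKernel R z' w ∂ν := fun ν => lintegral_dirac _ _
  -- The competitor is dominated by `lam + dirac z'`, of finite energy because `z'` is off the axis.
  have hσfin : mutualEnergy (reducedRatioKernel R) σ σ ≠ ⊤ := by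
    have hσle : σ ≤ lam + Measure.dirac z' := by
      refine add_le_add Measure.restrict_le_self ?_
      intro s
      simp only [Measure.smul_apply, smul_eq_mul]
      exact mul_le_of_le_one_left zero_le prob_le_one
    refine ne_top_of_le_ne_top ?_ (mutualEnergy_mono hσle hσle)
    rw [mutualEnergy_add_left, mutualEnergy_add_right hm, mutualEnergy_add_right hm,
      mutualEnergy_comm hm hsymm lam (Measure.dirac z'), hdirac, hdirac, lintegral_dirac]
    exact ENNReal.add_ne_top.2 ⟨ENNReal.add_ne_top.2 ⟨hfin, hUz'⟩,
      ENNReal.add_ne_top.2 ⟨hUz', reducedRatioKernel_ne_top hR hz'0 z'⟩⟩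
  have hle := mutualEnergy_self_le_of_minimal hm hsymm hlam' hmin hσprob hσfin
  have : IsProbabilityMeasure σ := hσprob.1
  rw [mutualEnergy_comm hm hsymm lam σ, hσ, mutualEnergy_add_left, mutualEnergy_smul_left,
    hdirac] at hle
  refine hle.not_gt ?_
  have hsplit : mutualEnergy (reducedRatioKernel R) lam lam =
      mutualEnergy (reducedRatioKernel R) (lam.restrict Vᶜ) lam + ∫⁻ z in V, U z ∂lam := by
    rw [add_comm]
    exact (lintegral_add_compl U hVo.measurableSet).symm
  have hfin' := hfin
  rw [hsplit] at hfin' ⊢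
  refine ENNReal.add_lt_add_left (ENNReal.add_ne_top.1 hfin').1 ?_
  calc lam V * U z' = ∫⁻ _ in V, U z' ∂lam := by rw [setLIntegral_const, mul_comm]
    _ < ∫⁻ z in V, U z ∂lam := by
      refine lintegral_strict_mono ?_ hUm.aemeasurable ?_ ?_
      · rw [Ne, Measure.restrict_eq_zero]; exact hVpos.ne'
      · rw [setLIntegral_const]; exact ENNReal.mul_ne_top hUz' (measure_ne_top _ _)
      · filter_upwards [ae_restrict_mem hVo.measurableSet] with w hw using hV w hw

end Support

/-! ### Assembly of the theorem -/

lemma re_pos_of_mem_interior {z : ℂ} (hz : z ∈ interior rightHalfPlane) : 0 < z.re := by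
  have h : interior rightHalfPlane = {z : ℂ | 0 < z.re} := Complex.interior_setOfPred_le_re 0
  rw [h] at hz
  exact hz

end RevolutionEnergy

end

theorem mainTheorem1 (A : Set ℂ) (hne : A.Nonempty) (hcompact : IsCompact A)
    (hA : A ⊆ rightHalfPlane) (hplus : rightMost A ⊆ interior rightHalfPlane) :
    ∃ (lam : Measure ℂ) (mu : Measure Space),
      IsEquilibriumMeasure reducedKernel A lam ∧
      IsEquilibriumMeasure logKernel (revolve A) mu ∧
      (∀ B : Set ℂ, MeasurableSet B → B ⊆ rightHalfPlane → lam B = mu (revolve B)) ∧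
      lam.support ⊆ rightMost A ∧
      mu.support ⊆ revolve (rightMost A) := by
  obtain ⟨C, hC⟩ := hcompact.isBounded.exists_norm_le
  -- `2 * C` puts everything in the ball of radius `R / 2`; the `1` makes the shift `log R`
  -- non-negative.
  set R : ℝ := max 1 (2 * C) with hRdef
  have hR1 : 1 ≤ R := le_max_left _ _
  have hR : 0 < R := by linarith
  have hAR : ∀ z ∈ A, ‖z‖ ≤ R / 2 := fun z hz => by
    have := hC z hz
    have := le_max_right 1 (2 * C)
    linarith
  have hAm := hcompact.isClosed.measurableSet
  have hrev := revolve_eq_preimage hA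
  have hSR : ∀ p ∈ revolve A, ‖p‖ ≤ R / 2 := fun p hp => by
    rw [hrev] at hp
    rw [← norm_cyl]
    exact hAR _ hp
  have hk := (continuous_reducedRatioKernel R).measurable
  obtain ⟨lam, hlam, hmin⟩ := exists_minimal_mutualEnergy hne hcompact
    (continuous_reducedRatioKernel R)
  -- The hypothesis on the right-most part enters here: it supplies a point of `A` off the axis,
  -- whose unit mass has finite energy.
  have hfin : mutualEnergy (reducedRatioKernel R) lam lam ≠ ⊤ := by
    obtain ⟨z, hz⟩ := hne
    obtain ⟨z', hz', hz'A, -⟩ := exists_mem_rightMost hcompact hz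
    have h0 := re_pos_of_mem_interior (hplus hz')
    refine ne_top_of_le_ne_top ?_ (hmin (Measure.dirac z') ⟨inferInstance, ?_⟩)
    · rw [mutualEnergy, lintegral_dirac, lintegral_dirac]
      exact reducedRatioKernel_ne_top hR h0 z'
    · simp [Measure.dirac_apply' _ hAm.compl, hz'A]
  have hae : ∀ ν ∈ probMeasuresOn A, ∀ᵐ z ∂ν, 0 ≤ z.re ∧ ‖z‖ ≤ R / 2 := fun ν hν =>
    Filter.Eventually.mono (p := fun z => z ∈ A) hν.2 fun z hz => ⟨hA hz, hAR z hz⟩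
  have hae' : ∀ ν ∈ probMeasuresOn (revolve A), ∀ᵐ p ∂ν, ‖p‖ ≤ R / 2 := fun ν hν =>
    Filter.Eventually.mono (p := fun p => p ∈ revolve A) hν.2 hSR
  have hmap : ∀ ν ∈ probMeasuresOn A, (lift ν).map cyl = ν := fun ν hν => by
    have := hν.1
    exact map_cyl_lift ((hae ν hν).mono fun z hz => hz.1)
  have hlift : ∀ ν ∈ probMeasuresOn A, lift ν ∈ probMeasuresOn (revolve A) := fun ν hν => by
    have := hν.1
    refine ⟨inferInstance, ?_⟩
    rw [hrev, ← Set.preimage_compl, ← Measure.map_apply continuous_cyl.measurable hAm.compl,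
      hmap ν hν]
    exact hν.2
  have hcyl : ∀ ν ∈ probMeasuresOn (revolve A), ν.map cyl ∈ probMeasuresOn A := fun ν hν => by
    have := hν.1
    refine ⟨Measure.isProbabilityMeasure_map continuous_cyl.measurable.aemeasurable, ?_⟩
    rw [Measure.map_apply continuous_cyl.measurable hAm.compl, Set.preimage_compl, ← hrev]
    exact hν.2
  have hmutual : ∀ ν ∈ probMeasuresOn (revolve A), ∀ η ∈ probMeasuresOn A,
      mutualEnergy (logRatioKernel R) ν (lift η) =
        mutualEnergy (reducedRatioKernel R) (ν.map cyl) η := fun ν hν η hη => by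
    have := hη.1
    exact mutualEnergy_lift hR (hae' ν hν) (hae η hη)
  have hself : ∀ η ∈ probMeasuresOn A, mutualEnergy (logRatioKernel R) (lift η) (lift η) =
      mutualEnergy (reducedRatioKernel R) η η := fun η hη => by
    rw [hmutual _ (hlift η hη) η hη, hmap η hη]
  have hcyl_le : ∀ ν ∈ probMeasuresOn (revolve A),
      mutualEnergy (reducedRatioKernel R) (ν.map cyl) (ν.map cyl) ≤
        mutualEnergy (logRatioKernel R) ν ν := fun ν hν => by
    have := hν.1
    exact mutualEnergy_map_cyl_le hR (hae' ν hν)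
  have hminS : ∀ ν ∈ probMeasuresOn (revolve A),
      mutualEnergy (logRatioKernel R) (lift lam) (lift lam) ≤
        mutualEnergy (logRatioKernel R) ν ν := fun ν hν => by
    rw [hself lam hlam]
    exact (hmin _ (hcyl ν hν)).trans (hcyl_le ν hν)
  have huniqS : ∀ ν ∈ probMeasuresOn (revolve A), mutualEnergy (logRatioKernel R) ν ν ≤
      mutualEnergy (logRatioKernel R) (lift lam) (lift lam) → ν = lift lam := fun ν hν hle => by
    have h1 := hν.1
    have h2 := (hlift lam hlam).1
    rw [hself lam hlam] at hle
    have hνfin : mutualEnergy (logRatioKernel R) ν ν ≠ ⊤ := ne_top_of_le_ne_top hfin hle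
    -- The variational inequality for `lam` against the projection of `ν`, carried to space.
    -- Combined with `hle` it gives the reverse of positive definiteness, which forces equality.
    have h3 : mutualEnergy (reducedRatioKernel R) lam lam ≤
        mutualEnergy (logRatioKernel R) ν (lift lam) := by
      have h4 := hcyl ν hν
      have := h4.1
      have := hlam.1
      rw [hmutual ν hν lam hlam, mutualEnergy_comm hk (reducedRatioKernel_comm R) (ν.map cyl) lam]
      exact mutualEnergy_self_le_of_minimal hk (reducedRatioKernel_comm R) hlam hmin h4
        (ne_top_of_le_ne_top hνfin (hcyl_le ν hν))
    have h5 := two_mul_mutualEnergy_le hR (hae' ν hν) (hae' _ (hlift lam hlam))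
    refine eq_of_mutualEnergy_le hR (hae' ν hν) (hae' _ (hlift lam hlam)) ?_ ?_
    · intro htop
      rw [htop, hself lam hlam, ENNReal.mul_top two_ne_zero, top_le_iff] at h5
      exact ENNReal.add_ne_top.2 ⟨hνfin, hfin⟩ h5
    · rw [hself lam hlam, two_mul]
      exact add_le_add (hle.trans h3) h3
  -- Uniqueness descends from space, since lifting preserves energies and `cyl` undoes it; no
  -- separate strict definiteness of the reduced kernel is needed.
  have huniq : ∀ η ∈ probMeasuresOn A, mutualEnergy (reducedRatioKernel R) η η ≤
      mutualEnergy (reducedRatioKernel R) lam lam → η = lam := fun η hη hle => by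
    rw [← hself η hη, ← hself lam hlam] at hle
    rw [← hmap η hη, huniqS _ (hlift η hη) hle, hmap lam hlam]
  have hsupp := support_subset_rightMost hcompact hA hAR hlam hfin hmin
  refine ⟨lam, lift lam, isEquilibriumMeasure_reducedKernel hR1 hAR hlam hfin hmin huniq,
    isEquilibriumMeasure_logKernel hR1 hSR (hlift lam hlam) (by rwa [hself lam hlam]) hminS huniqS,
    fun B hB hBH => ?_, hsupp, fun p hp => ?_⟩
  · rw [revolve_eq_preimage hBH, ← Measure.map_apply continuous_cyl.measurable hB, hmap lam hlam]
  · have hsub : rightMost A ⊆ rightHalfPlane := fun z hz => hA hz.1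
    rw [revolve_eq_preimage hsub]
    -- The continuous map `cyl` sends the support of the lift into the support of its image `lam`.
    refine hsupp ((Measure.mem_support_iff_forall _).2 fun W hW => ?_)
    obtain ⟨O, hOW, hO, hpO⟩ := mem_nhds_iff.1 hW
    have h := (Measure.mem_support_iff_forall p).1 hp (cyl ⁻¹' O)
      ((hO.preimage continuous_cyl).mem_nhds hpO)
    rw [← Measure.map_apply continuous_cyl.measurable hO.measurableSet, hmap lam hlam] at h
    exact h.trans_le (measure_mono hOW)
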